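/- Let $f=\{f_n:\{0,1\}^n\to\{0,1\}^n\}_{n\in\mathbb N}$ be a family of permutations and let $f^{-1}=\{f_n^{-1}\}_{n\in\mathbb N}$. 1. If $f\in\mathsf{inplaceFL}$, then for every $c\in\mathbb N$, $f^{-1}$ is computable in (errorless) $\mathsf{avgP}_{n^{-c}}$. 2. If $f\in\mathsf{inplaceFCL}$, then for every $c\in\mathbb N$, $f^{-1}$ is computable in (errorless) $\mathsf{avgZPP}_{n^{-c}}$. Here $f\in\mathsf{inplaceFCL}$ means that for some $k\in\mathbb N$ there is a Turing machine (with finitely many states and heads) working on a bounded tape over $\{0,1\}$ with end markers which, for every $n$, every $x\in\{0,1\}^n$ and every $\tau\in\{0,1\}^{n^k}$, when run on the tape $x\circ 0^{s}\circ\tau$ with $s=k\lceil\log_2 n\rceil$ (and $s=0$ for $n=0$), halts with the tape $f_n(x)\circ 1^{s}\circ\tau$. The class $\mathsf{inplaceFL}$ is defined in the same way without the catalytic part $\tau$. A family $g=\{g_n\}$ of functions on $\{0,1\}^n$ is computable in errorless $\mathsf{avgP}_{\varepsilon}$ (resp. $\mathsf{avgZPP}_{\varepsilon}$) if there is a deterministic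 (resp. randomized) polynomial-time machine $\mathcal A$ such that for every $n$ and every $x\in\{0,1\}^n$ the output $\mathcal A(x)$ always (resp. for every outcome of the internal randomness) lies in $\{g_n(x),\bot\}$, and $\mathcal A$ outputs $\bot$ with probability at most $\varepsilon(n)$ over a uniformly random $x\in\{0,1\}^n$ (resp. over $x$ and the internal randomness). For $n=0$ and $\varepsilon=n^{-c}$ the probability bound is taken to be void. -/

import Mathlib

namespace InPlace

/-! Bit strings of length `n` are functions `Fin n → Bool`; `List.ofFn` turns them into lists. -/

/-- What a head sees: one of the two end markers of the tape, or a bit. -/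
inductive Scan where
  | leftEnd
  | bit (b : Bool)
  | rightEnd

/-- Head movements. -/
inductive Move where
  | left
  | stay
  | right

/-- A Turing machine working on one bounded tape over the alphabet `{0,1}`. It has a finite set
of control states and a fixed number of heads (`headCount = 1` is the ordinary Turing machine).
A state determines the head that is active in it; according to the symbol seen by this head the
machine either halts (`none`) or passes to a new state, writes a bit at the position of the head
and moves the head. The machine has no storage apart from the tape, the state and the head
positions. -/
structure Machine where
  State : Type
  [stateFintype : Fintype State]
  headCount : ℕ
  start : State
  active : State → Fin headCount
  trans : State → Scan → Option (State × Bool × Move)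

/-- A configuration. Cells are numbered `1, …, tape.length`; the positions `0` and
`tape.length + 1` carry the end markers. -/
structure Cfg (M : Machine) where
  state : M.State
  tape : List Bool
  pos : Fin M.headCount → ℕ

/-- The symbol at position `p`. -/
def scan (tape : List Bool) : ℕ → Scan
  | 0 => Scan.leftEnd
  | p + 1 => match tape[p]? with
    | some b => Scan.bit b
    | none => Scan.rightEnd

/-- Write a bit at position `p`; at an end marker nothing is written. -/
def write (tape : List Bool) (b : Bool) : ℕ → List Bool
  | 0 => tape
  | p + 1 => tape.set p b

/-- Move a head on a tape with `N` cells; it cannot go beyond the end markers. -/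
def Move.apply (N p : ℕ) : Move → ℕ
  | Move.left => p - 1
  | Move.stay => p
  | Move.right => min (p + 1) (N + 1)

namespace Machine

/-- One step of the machine; `none` if the machine halts in this configuration. -/
def step (M : Machine) (C : Cfg M) : Option (Cfg M) :=
  let i := M.active C.state
  (M.trans C.state (scan C.tape (C.pos i))).map fun a =>
    { state := a.1
      tape := write C.tape a.2.1 (C.pos i)
      pos := Function.update C.pos i (a.2.2.apply C.tape.length (C.pos i)) }

/-- The initial configuration on a given tape: start state, all heads at the first position. -/
def init (M : Machine) (tape : List Bool) : Cfg M where
  state := M.start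
  tape := tape
  pos := fun _ => 1

/-- Run on the tape `t`, the machine halts with the tape being `t'`. -/
def HaltsWith (M : Machine) (t t' : List Bool) : Prop :=
  ∃ C : Cfg M, StateTransition.Reaches M.step (M.init t) C ∧ M.step C = none ∧ C.tape = t'

end Machine

/-- In-place computation with `s n` additional bits: from `x ∘ 0^{max(0,m(n)-n)} ∘ 0^s` the machine
halts with `f_n(x) ∘ 1^{max(0,n-m(n))} ∘ 1^s`. (Subtraction of natural numbers is truncated.) -/
def InplaceFSPACE (s : ℕ → ℕ) {m : ℕ → ℕ} (f : ∀ n, (Fin n → Bool) → (Fin (m n) → Bool)) : Prop :=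
  ∃ M : Machine, ∀ (n : ℕ) (x : Fin n → Bool),
    M.HaltsWith
      (List.ofFn x ++ List.replicate (m n - n) false ++ List.replicate (s n) false)
      (List.ofFn (f n x) ++ List.replicate (n - m n) true ++ List.replicate (s n) true)

/-- In-place computation with `s n` additional bits and `c n` catalytic bits: for every initial
content `τ` of the catalytic part, the machine started on `x ∘ 0^{max(0,m(n)-n)} ∘ 0^s ∘ τ`
halts with `f_n(x) ∘ 1^{max(0,n-m(n))} ∘ 1^s ∘ τ`. -/
def InplaceFCSPACE (s c : ℕ → ℕ) {m : ℕ → ℕ}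
    (f : ∀ n, (Fin n → Bool) → (Fin (m n) → Bool)) : Prop :=
  ∃ M : Machine, ∀ (n : ℕ) (x : Fin n → Bool) (τ : Fin (c n) → Bool),
    M.HaltsWith
      (List.ofFn x ++ List.replicate (m n - n) false ++ List.replicate (s n) false ++ List.ofFn τ)
      (List.ofFn (f n x) ++ List.replicate (n - m n) true ++ List.replicate (s n) true
        ++ List.ofFn τ)

/-- The class inplaceFL: the union over `k` of in-place computation with `k ⌈log₂ n⌉` additional
bits. -/
def InplaceFL {m : ℕ → ℕ} (f : ∀ n, (Fin n → Bool) → (Fin (m n) → Bool)) : Prop :=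
  ∃ k : ℕ, InplaceFSPACE (fun n => k * Nat.clog 2 n) f

/-- The class inplaceFCL: the union over `k` of in-place computation with `k ⌈log₂ n⌉` additional
bits and `n ^ k` catalytic bits. -/
def InplaceFCL {m : ℕ → ℕ} (f : ∀ n, (Fin n → Bool) → (Fin (m n) → Bool)) : Prop :=
  ∃ k : ℕ, InplaceFCSPACE (fun n => k * Nat.clog 2 n) (fun n => n ^ k) f

/-- Encoding of the output of an algorithm: a bit string, or `⊥` (here `none`). -/
def encodeOutput : Option (List Bool) → List (Option Bool)
  | some y => y.map some
  | none => [none]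

/-- Encoding of an input `x` of length `n`. -/
def encodeInput (z : (n : ℕ) × (Fin n → Bool)) : List Bool := List.ofFn z.2

/-- Encoding of an input `x` of length `n` together with `ℓ n` random bits `r`: `x`, a separator,
and `r`. -/
def encodeRandInput (ℓ : ℕ → ℕ) (z : (n : ℕ) × (Fin n → Bool) × (Fin (ℓ n) → Bool)) :
    List (Option Bool) :=
  (List.ofFn z.2.1).map some ++ none :: (List.ofFn z.2.2).map some

/-- The probability of an event over a uniformly random element of a finite type. -/
noncomputable def uniformProb {α : Type} [Fintype α] [Nonempty α] (E : Set α) : ENNReal :=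
  (PMF.uniformOfFintype α).toOuterMeasure E

/-- Errorless average-case polynomial time `avgP_ε`: a polynomial-time algorithm `A` with
`A(x) ∈ {g(x), ⊥}` for all `x`, and `Pr[A(x) = ⊥] ≤ ε(n)` over a uniformly random `x` of
length `n`. -/
def AvgP (ε : ℕ → ENNReal) {m : ℕ → ℕ} (g : ∀ n, (Fin n → Bool) → (Fin (m n) → Bool)) : Prop :=
  ∃ A : ((n : ℕ) × (Fin n → Bool)) → Option (List Bool),
    Nonempty (Turing.TM2ComputableInPolyTime encodeInput encodeOutput A) ∧
    ∀ n : ℕ,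
      (∀ x : Fin n → Bool, A ⟨n, x⟩ = some (List.ofFn (g n x)) ∨ A ⟨n, x⟩ = none) ∧
      uniformProb {x : Fin n → Bool | A ⟨n, x⟩ = none} ≤ ε n

/-- Errorless average-case randomized polynomial time `avgZPP_ε`: a polynomial-time algorithm `A`
that gets, besides the input `x` of length `n`, a string `r` of `ℓ(n)` random bits, where `ℓ` is a
polynomial, with `A(x; r) ∈ {g(x), ⊥}` for all `x` and `r`, and `Pr[A(x; r) = ⊥] ≤ ε(n)` over
uniformly random `x` of length `n` and `r`. -/
def AvgZPP (ε : ℕ → ENNReal) {m : ℕ → ℕ} (g : ∀ n, (Fin n → Bool) → (Fin (m n) → Bool)) : Prop :=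
  ∃ (ℓ : Polynomial ℕ)
    (A : ((n : ℕ) × (Fin n → Bool) × (Fin (ℓ.eval n) → Bool)) → Option (List Bool)),
    Nonempty (Turing.TM2ComputableInPolyTime (encodeRandInput fun n => ℓ.eval n) encodeOutput A) ∧
    ∀ n : ℕ,
      (∀ (x : Fin n → Bool) (r : Fin (ℓ.eval n) → Bool),
        A ⟨n, x, r⟩ = some (List.ofFn (g n x)) ∨ A ⟨n, x, r⟩ = none) ∧
      uniformProb {z : (Fin n → Bool) × (Fin (ℓ.eval n) → Bool) | A ⟨n, z.1, z.2⟩ = none} ≤ ε n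

end InPlace

/-! The machine is run backwards. Its steps are deterministic, so the configurations from which a
fixed halting configuration R is reached form a finite tree with root R. After normalization
(`Machine.normalize`) all heads start and end at the left marker, so y and τ determine one root,
with tape y 1^s τ, and the start configuration with tape f⁻¹(y) 0^s τ is a node of its tree. An
Euler tour of this tree needs no stack: the parent of a node is its forward successor, and its
possible children are numbered by the finitely many pairs of a state and a scanned symbol, each of
which can be undone locally. Hence the tour is itself a machine, `Machine.tour`, with the same tape
and heads, and it visits every node (`Machine.reaches_explore_zero`).

The algorithm follows the tour from the root for (N+2)^d steps, where N = n+s+ℓ is the tape length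
and ℓ = |τ|, and answers ⊥ unless a start configuration with a tape x 0^s τ occurs. An answer is
never wrong, since everything visited belongs to the tree of the root (`Machine.reaches_of_invert`,
`invert_eq_or`).

A single tree can be exponentially large, but failures are rare on average. Trees of different roots
are disjoint, and so are their tours (`Cfg.Tours.unique`). On a failed run all visited tour
configurations are distinct, because a repetition would trap the tour in a cycle avoiding the start
configuration that it has to visit (`Machine.iterate_injOn`). So the number of failing pairs (y, τ),
times (N+2)^d, is at most the number Q·2^N·(N+2)^h of all tour configurations, with Q states and h
heads (`card_invert_eq_none_mul_le`). As s is logarithmic, 2^s is polynomial, and a large d brings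
the failing fraction below n^{-c}. For inplaceFCL the random bits serve as τ; for inplaceFL, ℓ = 0.

It remains to carry out such a search in polynomial time on a `TM2` machine. Structured stack
programs with composable time bounds are compiled to `TM2`, and one of them simulates an arbitrary
multi-head machine against a clock (`Prg.nonempty_computable`). -/

namespace InPlace

open Turing

/-! ### Structured programs on finitely many stacks -/

/-- Structured programs on stacks `k : K` over the alphabets `Γ k` with local variables `σ`.
The program `loop k f c p` pops from `k`, updates the variables by `f`, and if `c` holds then
runs `p` and starts again. -/
inductive StackProg (K : Type) (Γ : K → Type) (σ : Type) : Type where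
  | push (k : K) (f : σ → Γ k)
  | pop (k : K) (f : σ → Option (Γ k) → σ)
  | load (f : σ → σ)
  | seq (p q : StackProg K Γ σ)
  | ite (c : σ → Bool) (p q : StackProg K Γ σ)
  | switch (n : ℕ) (f : σ → Fin n) (p : Fin n → StackProg K Γ σ)
  | loop (k : K) (f : σ → Option (Γ k) → σ) (c : σ → Bool) (p : StackProg K Γ σ)

namespace StackProg

variable {K : Type} {Γ : K → Type} {σ : Type}

/-- The labels used by the compiled program. -/
def Label : StackProg K Γ σ → Type
  | push _ _ => Unit
  | pop _ _ => Unit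
  | load _ => Unit
  | seq p q => Label p ⊕ Label q
  | ite _ p q => Option (Label p ⊕ Label q)
  | switch n _ p => Option (Σ i : Fin n, Label (p i))
  | loop _ _ _ p => Option (Label p)

theorem finite_label (p : StackProg K Γ σ) : Finite (Label p) := by
  induction p with
  | push | pop | load => exact inferInstanceAs (Finite Unit)
  | seq p q hp hq => exact inferInstanceAs (Finite (Label p ⊕ Label q))
  | ite c p q hp hq => exact inferInstanceAs (Finite (Option (Label p ⊕ Label q)))
  | switch n f p hp => exact inferInstanceAs (Finite (Option (Σ i : Fin n, Label (p i))))
  | loop k f c p hp => exact inferInstanceAs (Finite (Option (Label p)))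

/-- The label at which the compiled program starts. -/
def entry : (p : StackProg K Γ σ) → Label p
  | push _ _ => ()
  | pop _ _ => ()
  | load _ => ()
  | seq p _ => Sum.inl (entry p)
  | ite _ _ _ => none
  | switch _ _ _ => none
  | loop _ _ _ _ => none

/-- The compiled program, with labels embedded by `e` and jumping to `x` at the end. -/
def code {Λ : Type} : (p : StackProg K Γ σ) → (Label p → Λ) → Λ → Label p → TM2.Stmt Γ Λ σ
  | push k f, _, x, _ => .push k f (.goto fun _ => x)
  | pop k f, _, x, _ => .pop k f (.goto fun _ => x)
  | load f, _, x, _ => .load f (.goto fun _ => x)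
  | seq p q, e, _, Sum.inl l =>
      code p (fun l => e (Sum.inl l)) (e (Sum.inr (entry q))) l
  | seq _ q, e, x, Sum.inr l => code q (fun l => e (Sum.inr l)) x l
  | ite c p q, e, _, none =>
      .goto fun v => if c v then e (some (Sum.inl (entry p))) else e (some (Sum.inr (entry q)))
  | ite _ p _, e, x, some (Sum.inl l) => code p (fun l => e (some (Sum.inl l))) x l
  | ite _ _ q, e, x, some (Sum.inr l) => code q (fun l => e (some (Sum.inr l))) x l
  | switch _ f p, e, _, none => .goto fun v => e (some ⟨f v, entry (p (f v))⟩)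
  | switch _ _ p, e, x, some ⟨i, l⟩ => code (p i) (fun l => e (some ⟨i, l⟩)) x l
  | loop k f c p, e, x, none =>
      .pop k f (.goto fun v => if c v then e (some (entry p)) else x)
  | loop _ _ _ p, e, _, some l => code p (fun l => e (some l)) (e none) l

variable [DecidableEq K]

theorem step_some {Λ : Type} (m : Λ → TM2.Stmt Γ Λ σ) (l : Λ) (v : σ) (S : ∀ k, List (Γ k)) :
    TM2.step m ⟨some l, v, S⟩ = some (TM2.stepAux (m l) v S) := rfl

/-- `n` steps of a stack machine. -/
def StepsIn {Λ : Type} (m : Λ → TM2.Stmt Γ Λ σ) (n : ℕ) (c c' : TM2.Cfg Γ Λ σ) : Prop :=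
  (flip bind (TM2.step m))^[n] (some c) = some c'

theorem StepsIn.single {Λ : Type} {m : Λ → TM2.Stmt Γ Λ σ} {c c' : TM2.Cfg Γ Λ σ}
    (h : TM2.step m c = some c') : StepsIn m 1 c c' := h

theorem StepsIn.trans {Λ : Type} {m : Λ → TM2.Stmt Γ Λ σ} {n n' : ℕ}
    {c c' c'' : TM2.Cfg Γ Λ σ} (h : StepsIn m n c c') (h' : StepsIn m n' c' c'') :
    StepsIn m (n + n') c c'' := by
  unfold StepsIn at *
  rw [add_comm, Function.iterate_add_apply, h, h']

/-- The program `p` takes the variables `v` and the stacks `S` to `v'` and `S'` in at most `t`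
steps. -/
def Runs (p : StackProg K Γ σ) (v : σ) (S : ∀ k, List (Γ k)) (v' : σ) (S' : ∀ k, List (Γ k))
    (t : ℕ) : Prop :=
  ∀ (Λ : Type) (m : Λ → TM2.Stmt Γ Λ σ) (e : Label p → Λ) (x : Λ),
    (∀ l, m (e l) = code p e x l) →
      ∃ n ≤ t, StepsIn m n ⟨some (e (entry p)), v, S⟩ ⟨some x, v', S'⟩

variable {v v' v'' : σ} {S S' S'' : ∀ k, List (Γ k)} {t t' : ℕ} {p q : StackProg K Γ σ}

theorem Runs.mono (h : Runs p v S v' S' t) (ht : t ≤ t') : Runs p v S v' S' t' :=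
  fun Λ m e x hm => (h Λ m e x hm).imp fun _ hn => ⟨hn.1.trans ht, hn.2⟩

theorem runs_push {k : K} {f : σ → Γ k} (hS : Function.update S k (f v :: S k) = S') :
    Runs (push k f) v S v S' 1 := by
  intro Λ m e x hm
  refine ⟨1, le_rfl, StepsIn.single ?_⟩
  simp [hm, code, hS]

theorem runs_pop {k : K} {f : σ → Option (Γ k) → σ} (hv : f v (S k).head? = v')
    (hS : Function.update S k (S k).tail = S') : Runs (pop k f) v S v' S' 1 := by
  intro Λ m e x hm
  refine ⟨1, le_rfl, StepsIn.single ?_⟩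
  simp [hm, code, hv, hS]

theorem runs_load (f : σ → σ) (v : σ) (S : ∀ k, List (Γ k)) : Runs (load f) v S (f v) S 1 := by
  intro Λ m e x hm
  refine ⟨1, le_rfl, StepsIn.single ?_⟩
  simp [hm, code]

theorem Runs.seq (hp : Runs p v S v' S' t) (hq : Runs q v' S' v'' S'' t') :
    Runs (seq p q) v S v'' S'' (t + t') := by
  intro Λ m e x hm
  obtain ⟨n, hn, h⟩ := hp Λ m (fun l => e (Sum.inl l)) (e (Sum.inr (entry q)))
    fun l => hm (Sum.inl l)
  obtain ⟨n', hn', h'⟩ := hq Λ m (fun l => e (Sum.inr l)) x fun l => hm (Sum.inr l)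
  exact ⟨n + n', add_le_add hn hn', h.trans h'⟩

theorem Runs.ite_true {c : σ → Bool} (hc : c v = true) (hp : Runs p v S v' S' t) :
    Runs (ite c p q) v S v' S' (t + 1) := by
  intro Λ m e x hm
  obtain ⟨n, hn, h⟩ := hp Λ m (fun l => e (some (Sum.inl l))) x fun l => hm (some (Sum.inl l))
  refine ⟨1 + n, by omega, (StepsIn.single ?_).trans h⟩
  rw [step_some, hm]; simp [entry, code, hc]

theorem Runs.ite_false {c : σ → Bool} (hc : c v = false) (hq : Runs q v S v' S' t) :
    Runs (ite c p q) v S v' S' (t + 1) := by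
  intro Λ m e x hm
  obtain ⟨n, hn, h⟩ := hq Λ m (fun l => e (some (Sum.inr l))) x fun l => hm (some (Sum.inr l))
  refine ⟨1 + n, by omega, (StepsIn.single ?_).trans h⟩
  rw [step_some, hm]; simp [entry, code, hc]

theorem Runs.switch {n : ℕ} {f : σ → Fin n} {p : Fin n → StackProg K Γ σ}
    (hp : Runs (p (f v)) v S v' S' t) : Runs (switch n f p) v S v' S' (t + 1) := by
  intro Λ m e x hm
  obtain ⟨n, hn, h⟩ := hp Λ m (fun l => e (some ⟨f v, l⟩)) x fun l => hm (some ⟨f v, l⟩)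
  refine ⟨1 + n, by omega, (StepsIn.single ?_).trans h⟩
  rw [step_some, hm]; simp [entry, code]

theorem runs_loop_exit {k : K} {f : σ → Option (Γ k) → σ} {c : σ → Bool}
    (hv : f v (S k).head? = v') (hS : Function.update S k (S k).tail = S') (hc : c v' = false) :
    Runs (loop k f c p) v S v' S' 1 := by
  intro Λ m e x hm
  refine ⟨1, le_rfl, StepsIn.single ?_⟩
  rw [step_some, hm]; simp [entry, code, hc, hv, hS]

theorem Runs.loop {k : K} {f : σ → Option (Γ k) → σ} {c : σ → Bool} {v₁ : σ}
    {S₁ : ∀ k, List (Γ k)} (hv : f v (S k).head? = v₁)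
    (hS : Function.update S k (S k).tail = S₁) (hc : c v₁ = true)
    (hp : Runs p v₁ S₁ v' S' t) (hl : Runs (loop k f c p) v' S' v'' S'' t') :
    Runs (loop k f c p) v S v'' S'' (1 + t + t') := by
  intro Λ m e x hm
  obtain ⟨n, hn, h⟩ := hp Λ m (fun l => e (some l)) (e none) fun l => hm (some l)
  obtain ⟨n', hn', h'⟩ := hl Λ m e x hm
  refine ⟨1 + n + n', by omega, ((StepsIn.single ?_).trans h).trans h'⟩
  rw [step_some, hm]; simp [entry, code, hc, hv, hS]

/-- The left side is the form in which `initList` and `haltList` present the stacks; the right side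
is the form used for programs. -/
theorem dite_eq_update (k₀ : K) (l : List (Γ k₀)) :
    (fun k => @dite (List (Γ k)) (k = k₀) (inferInstanceAs (Decidable (k = k₀)))
      (fun h => by rw [h]; exact l) fun _ => []) = Function.update (fun _ => []) k₀ l := by
  funext k
  by_cases hk : k = k₀
  · subst hk; simp
  · simp [hk]

/-- The machine running a program, with designated input and output stacks. -/
noncomputable def toFinTM2 [Fintype K] [Fintype σ] (p : StackProg K Γ σ) (k₀ k₁ : K)
    [Fintype (Γ k₀)] (v₀ : σ) : FinTM2 where
  K := K
  k₀ := k₀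
  k₁ := k₁
  Γ := Γ
  Λ := Option (Label p)
  main := some (entry p)
  ΛFin := haveI := finite_label p; Fintype.ofFinite _
  σ := σ
  initialState := v₀
  m l := match l with
    | none => .halt
    | some l => code p some none l

theorem Runs.outputsInTime [Fintype K] [Fintype σ] {k₀ k₁ : K} [Fintype (Γ k₀)]
    {v₀ : σ} {l : List (Γ k₀)} {l' : List (Γ k₁)}
    (h : Runs p v₀ (Function.update (fun _ => []) k₀ l) v₀
      (Function.update (fun _ => []) k₁ l') t) :
    Nonempty (TM2OutputsInTime (toFinTM2 p k₀ k₁ v₀) l (some l') (t + 1)) := by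
  obtain ⟨n, hn, h⟩ := h (Option (Label p)) (toFinTM2 p k₀ k₁ v₀).m some none fun _ => rfl
  have hi : initList (toFinTM2 p k₀ k₁ v₀) l =
      (⟨some (some (entry p)), v₀, Function.update (fun _ => []) k₀ l⟩ :
        TM2.Cfg Γ (Option (Label p)) σ) :=
    congrArg (TM2.Cfg.mk _ _) (dite_eq_update k₀ l)
  have ho : haltList (toFinTM2 p k₀ k₁ v₀) l' =
      (⟨none, v₀, Function.update (fun _ => []) k₁ l'⟩ :
        TM2.Cfg Γ (Option (Label p)) σ) :=
    congrArg (TM2.Cfg.mk _ _) (dite_eq_update k₁ l')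
  -- The additional step executes `halt` at the exit label `none`.
  refine ⟨⟨⟨n + 1, ?_⟩, Nat.succ_le_succ hn⟩⟩
  rw [hi]
  exact Eq.trans (h.trans (StepsIn.single rfl)) (congrArg some ho.symm)

end StackProg
end InPlace

namespace InPlace

open Turing

instance : Finite Scan :=
  Finite.of_injective (β := Option (Option Bool))
    (fun | .leftEnd => none | .rightEnd => some none | .bit b => some (some b))
    (by rintro (_ | _ | _) (_ | _ | _) <;> simp)

/-! ### The stack machine simulating a machine on a bounded tape -/

/-- The stacks of the simulation: the input, the output, the tape to the right and to the left of
the current cell, two counters, and for each head a counter holding its position. -/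
inductive Stk (h : ℕ) where
  | inp
  | out
  | left
  | right
  | cntA
  | cntB
  | head (i : Fin h)
deriving DecidableEq

instance (h : ℕ) : Finite (Stk h) :=
  Finite.of_injective (β := Fin 6 ⊕ Fin h)
    (fun | .inp => Sum.inl 0 | .out => Sum.inl 1 | .left => Sum.inl 2 | .right => Sum.inl 3
         | .cntA => Sum.inl 4 | .cntB => Sum.inl 5 | .head i => Sum.inr i)
    (by rintro (_ | _ | _ | _ | _ | _ | _) (_ | _ | _ | _ | _ | _ | _) <;> simp)

/-- A cell of the simulated tape: its content, and the content that is required in the end. -/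
abbrev Cell := Bool × Option Bool

/-- The stack alphabets. -/
abbrev Stk.Alphabet {h : ℕ} (α : Type) : Stk h → Type
  | .inp => α
  | .out => Option Bool
  | .left => Cell
  | .right => Cell
  | .cntA => Unit
  | .cntB => Unit
  | .head _ => Unit

/-- The local variables of the simulation. -/
@[ext]
structure Var (α S : Type) where
  state : S
  sym : Scan := .leftEnd
  cnt : Fin 3 := 0
  inb : Option α := none
  cell : Option Cell := none
  tok : Bool := false
  par : Bool := false
  found : Bool := false

instance (α S : Type) [Finite α] [Finite S] : Finite (Var α S) :=
  Finite.of_injective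
    (β := S × Scan × Fin 3 × Option α × Option Cell × Bool × Bool × Bool)
    (fun v => (v.state, v.sym, v.cnt, v.inb, v.cell, v.tok, v.par, v.found))
    (by
      intro v w h
      simp only [Prod.mk.injEq] at h
      obtain ⟨h1, h2, h3, h4, h5, h6, h7, h8⟩ := h
      exact Var.ext h1 h2 h3 h4 h5 h6 h7 h8)

/-- The contents of the stacks. -/
structure Mem (h : ℕ) (α : Type) where
  inp : List α := []
  out : List (Option Bool) := []
  left : List Cell := []
  right : List Cell := []
  a : ℕ := 0
  b : ℕ := 0
  head : Fin h → ℕ := fun _ => 0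

namespace Mem

variable {h : ℕ} {α : Type} (m : Mem h α)

/-- The stacks with given contents. -/
def stk : ∀ k : Stk h, List (k.Alphabet α)
  | .inp => m.inp
  | .out => m.out
  | .left => m.left
  | .right => m.right
  | .cntA => List.replicate m.a ()
  | .cntB => List.replicate m.b ()
  | .head i => List.replicate (m.head i) ()

/-- This and the following rules turn updates of the dependent family of stacks into record updates,
so that memories can be compared field by field. -/
theorem update_inp (l : List α) :
    Function.update m.stk .inp l = { m with inp := l }.stk := by
  funext k; cases k <;> simp [stk]

theorem update_out (l : List (Option Bool)) :
    Function.update m.stk .out l = { m with out := l }.stk := by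
  funext k; cases k <;> simp [stk]

theorem update_left (l : List Cell) :
    Function.update m.stk .left l = { m with left := l }.stk := by
  funext k; cases k <;> simp [stk]

theorem update_right (l : List Cell) :
    Function.update m.stk .right l = { m with right := l }.stk := by
  funext k; cases k <;> simp [stk]

theorem update_cntA (n : ℕ) :
    Function.update m.stk .cntA (List.replicate n ()) = { m with a := n }.stk := by
  funext k; cases k <;> simp [stk]

theorem update_cntB (n : ℕ) :
    Function.update m.stk .cntB (List.replicate n ()) = { m with b := n }.stk := by
  funext k; cases k <;> simp [stk]

theorem update_head (i : Fin h) (n : ℕ) :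
    Function.update m.stk (.head i) (List.replicate n ()) =
      { m with head := Function.update m.head i n }.stk := by
  funext k
  cases k with
  | head j => by_cases hj : j = i
              · subst hj; simp [stk]
              · simp [stk, hj]
  | _ => simp [stk]

end Mem

/-- The programs used in the simulation. -/
abbrev Prg (h : ℕ) (α S : Type) := StackProg (Stk h) (Stk.Alphabet α) (Var α S)

namespace Prg

open StackProg

variable {h : ℕ} {α S : Type}

/-- The program `p` takes the variables `v` and the memory `m` to `v'` and `m'` in at most `t`
steps. -/
def Exec (p : Prg h α S) (v : Var α S) (m : Mem h α) (v' : Var α S) (m' : Mem h α) (t : ℕ) : Prop :=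
  Runs p v m.stk v' m'.stk t

section Basic

variable {p q : Prg h α S} {v v' v'' : Var α S} {m m' m'' : Mem h α} {t t' : ℕ}

theorem Exec.mono (hp : Exec p v m v' m' t) (ht : t ≤ t') : Exec p v m v' m' t' :=
  Runs.mono hp ht

theorem Exec.cast (hp : Exec p v m v' m' t) (hv : v' = v'') (hm : m' = m'') (ht : t ≤ t') :
    Exec p v m v'' m'' t' := by
  subst hv hm; exact hp.mono ht

theorem Exec.seq (hp : Exec p v m v' m' t) (hq : Exec q v' m' v'' m'' t') :
    Exec (.seq p q) v m v'' m'' (t + t') :=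
  Runs.seq hp hq

theorem Exec.ite_true {c : Var α S → Bool} (hc : c v = true) (hp : Exec p v m v' m' t) :
    Exec (.ite c p q) v m v' m' (t + 1) :=
  Runs.ite_true hc hp

theorem Exec.ite_false {c : Var α S → Bool} (hc : c v = false) (hq : Exec q v m v' m' t) :
    Exec (.ite c p q) v m v' m' (t + 1) :=
  Runs.ite_false hc hq

theorem Exec.switch {n : ℕ} {f : Var α S → Fin n} {p : Fin n → Prg h α S}
    (hp : Exec (p (f v)) v m v' m' t) : Exec (.switch n f p) v m v' m' (t + 1) :=
  Runs.switch hp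

theorem exec_load (f : Var α S → Var α S) (v : Var α S) (m : Mem h α) :
    Exec (.load f) v m (f v) m 1 :=
  runs_load f v _

end Basic

def skip : Prg h α S := load id

theorem exec_skip (v : Var α S) (m : Mem h α) : Exec skip v m v m 1 :=
  exec_load id v m

def pushLeft (f : Var α S → Cell) : Prg h α S := push .left f
def pushRight (f : Var α S → Cell) : Prg h α S := push .right f
def pushOut (f : Var α S → Option Bool) : Prg h α S := push .out f
def pushA : Prg h α S := push .cntA fun _ => ()
def pushB : Prg h α S := push .cntB fun _ => ()
def pushHead (i : Fin h) : Prg h α S := push (.head i) fun _ => ()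
def setInb (v : Var α S) (x : Option α) : Var α S := { v with inb := x }
def setCell (v : Var α S) (c : Option Cell) : Var α S := { v with cell := c }
def setTok (v : Var α S) (b : Bool) : Var α S := { v with tok := b }
def popLeft : Prg h α S := pop .left setCell
def popRight : Prg h α S := pop .right setCell
def popA : Prg h α S := pop .cntA fun v c => setTok v c.isSome
def popHead (i : Fin h) : Prg h α S := pop (.head i) fun v c => setTok v c.isSome

section Prim

variable (v : Var α S) (m : Mem h α)

theorem exec_pushLeft (f : Var α S → Cell) :
    Exec (pushLeft f) v m v { m with left := f v :: m.left } 1 :=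
  runs_push (k := (.left : Stk h)) (m.update_left _)

theorem exec_pushRight (f : Var α S → Cell) :
    Exec (pushRight f) v m v { m with right := f v :: m.right } 1 :=
  runs_push (k := (.right : Stk h)) (m.update_right _)

theorem exec_pushOut (f : Var α S → Option Bool) :
    Exec (pushOut f) v m v { m with out := f v :: m.out } 1 :=
  runs_push (k := (.out : Stk h)) (m.update_out _)

theorem exec_pushA : Exec pushA v m v { m with a := m.a + 1 } 1 :=
  runs_push (k := (.cntA : Stk h)) (m.update_cntA (m.a + 1))

theorem exec_pushB : Exec pushB v m v { m with b := m.b + 1 } 1 :=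
  runs_push (k := (.cntB : Stk h)) (m.update_cntB (m.b + 1))

theorem exec_pushHead (i : Fin h) : Exec (pushHead i) v m v
    { m with head := Function.update m.head i (m.head i + 1) } 1 :=
  runs_push (k := (.head i : Stk h)) (m.update_head i (m.head i + 1))

theorem exec_popLeft :
    Exec popLeft v m (setCell v m.left.head?) { m with left := m.left.tail } 1 :=
  runs_pop (k := (.left : Stk h)) rfl (m.update_left _)

theorem exec_popRight :
    Exec popRight v m (setCell v m.right.head?) { m with right := m.right.tail } 1 :=
  runs_pop (k := (.right : Stk h)) rfl (m.update_right _)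

theorem head?_replicate_isSome (n : ℕ) :
    (List.replicate n ()).head?.isSome = decide (n ≠ 0) := by
  cases n <;> simp [List.replicate_succ]

theorem exec_popA : Exec popA v m (setTok v (decide (m.a ≠ 0))) { m with a := m.a - 1 } 1 :=
  runs_pop (k := (.cntA : Stk h)) (congrArg (setTok v) (head?_replicate_isSome m.a))
    ((congrArg _ List.tail_replicate).trans (m.update_cntA _))

theorem exec_popHead (i : Fin h) : Exec (popHead i) v m (setTok v (decide (m.head i ≠ 0)))
    { m with head := Function.update m.head i (m.head i - 1) } 1 :=
  runs_pop (k := (.head i : Stk h)) (congrArg (setTok v) (head?_replicate_isSome (m.head i)))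
    ((congrArg _ List.tail_replicate).trans (m.update_head i _))

end Prim

/-! Loops over the stacks. -/

/-- The symbol that ends the loop is consumed as well; this removes the separator in front of the
random bits. -/
def eachInp (c : α → Bool) (p : Prg h α S) : Prg h α S :=
  loop .inp setInb (fun v => v.inb.any c) p

def eachLeft (p : Prg h α S) : Prg h α S :=
  loop .left setCell (fun v => v.cell.isSome) p

def eachRight (p : Prg h α S) : Prg h α S :=
  loop .right setCell (fun v => v.cell.isSome) p

def eachA (p : Prg h α S) : Prg h α S :=
  loop .cntA (fun v c => setTok v c.isSome) (fun v => v.tok) p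

def eachB (p : Prg h α S) : Prg h α S :=
  loop .cntB (fun v c => setTok v c.isSome) (fun v => v.tok) p

def eachHead (i : Fin h) (p : Prg h α S) : Prg h α S :=
  loop (.head i) (fun v c => setTok v c.isSome) (fun v => v.tok) p

section Loops

variable {v v' v'' : Var α S} {m m' m'' : Mem h α} {p : Prg h α S} {t t' : ℕ}

theorem eachInp_exit {c : α → Bool} (hc : m.inp.head?.any c = false) :
    Exec (eachInp c p) v m (setInb v m.inp.head?) { m with inp := m.inp.tail } 1 :=
  runs_loop_exit (k := (.inp : Stk h)) rfl (m.update_inp _) hc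

theorem eachInp_step {c : α → Bool} {x : α} {l : List α} (hm : m.inp = x :: l) (hc : c x = true)
    (hp : Exec p (setInb v (some x)) { m with inp := l } v' m' t)
    (hl : Exec (eachInp c p) v' m' v'' m'' t') :
    Exec (eachInp c p) v m v'' m'' (1 + t + t') := by
  have hx : m.stk .inp = x :: l := hm
  exact Runs.loop (k := (.inp : Stk h)) (v₁ := setInb v (some x)) (by rw [hx]; rfl)
    ((m.update_inp _).trans (by rw [hx, List.tail_cons])) hc hp hl

theorem eachLeft_exit (hm : m.left = []) : Exec (eachLeft p) v m (setCell v none) m 1 := by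
  have hx : m.stk .left = [] := hm
  refine runs_loop_exit (k := (.left : Stk h)) (by rw [hx]; rfl)
    ((m.update_left _).trans ?_) rfl
  rw [hx, List.tail_nil, ← hm]

theorem eachLeft_step {x : Cell} {l : List Cell} (hm : m.left = x :: l)
    (hp : Exec p (setCell v (some x)) { m with left := l } v' m' t)
    (hl : Exec (eachLeft p) v' m' v'' m'' t') :
    Exec (eachLeft p) v m v'' m'' (1 + t + t') := by
  have hx : m.stk .left = x :: l := hm
  exact Runs.loop (k := (.left : Stk h)) (v₁ := setCell v (some x)) (by rw [hx]; rfl)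
    ((m.update_left _).trans (by rw [hx, List.tail_cons])) rfl hp hl

theorem eachRight_exit (hm : m.right = []) : Exec (eachRight p) v m (setCell v none) m 1 := by
  have hx : m.stk .right = [] := hm
  refine runs_loop_exit (k := (.right : Stk h)) (by rw [hx]; rfl)
    ((m.update_right _).trans ?_) rfl
  rw [hx, List.tail_nil, ← hm]

theorem eachRight_step {x : Cell} {l : List Cell} (hm : m.right = x :: l)
    (hp : Exec p (setCell v (some x)) { m with right := l } v' m' t)
    (hl : Exec (eachRight p) v' m' v'' m'' t') :
    Exec (eachRight p) v m v'' m'' (1 + t + t') := by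
  have hx : m.stk .right = x :: l := hm
  exact Runs.loop (k := (.right : Stk h)) (v₁ := setCell v (some x)) (by rw [hx]; rfl)
    ((m.update_right _).trans (by rw [hx, List.tail_cons])) rfl hp hl

theorem eachA_exit (hm : m.a = 0) : Exec (eachA p) v m (setTok v false) m 1 := by
  have hx : m.stk .cntA = List.replicate 0 () := congrArg (List.replicate · ()) hm
  refine runs_loop_exit (k := (.cntA : Stk h)) (by rw [hx]; rfl) ?_ rfl
  rw [hx]
  exact (m.update_cntA 0).trans (by rw [← hm])

theorem eachA_step {n : ℕ} (hm : m.a = n + 1)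
    (hp : Exec p (setTok v true) { m with a := n } v' m' t)
    (hl : Exec (eachA p) v' m' v'' m'' t') :
    Exec (eachA p) v m v'' m'' (1 + t + t') := by
  have hx : m.stk .cntA = List.replicate (n + 1) () := congrArg (List.replicate · ()) hm
  exact Runs.loop (k := (.cntA : Stk h)) (v₁ := setTok v true) (by rw [hx]; rfl)
    (by rw [hx]; exact m.update_cntA n) rfl hp hl

theorem eachB_exit (hm : m.b = 0) : Exec (eachB p) v m (setTok v false) m 1 := by
  have hx : m.stk .cntB = List.replicate 0 () := congrArg (List.replicate · ()) hm
  refine runs_loop_exit (k := (.cntB : Stk h)) (by rw [hx]; rfl) ?_ rfl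
  rw [hx]
  exact (m.update_cntB 0).trans (by rw [← hm])

theorem eachB_step {n : ℕ} (hm : m.b = n + 1)
    (hp : Exec p (setTok v true) { m with b := n } v' m' t)
    (hl : Exec (eachB p) v' m' v'' m'' t') :
    Exec (eachB p) v m v'' m'' (1 + t + t') := by
  have hx : m.stk .cntB = List.replicate (n + 1) () := congrArg (List.replicate · ()) hm
  exact Runs.loop (k := (.cntB : Stk h)) (v₁ := setTok v true) (by rw [hx]; rfl)
    (by rw [hx]; exact m.update_cntB n) rfl hp hl

theorem eachHead_exit {i : Fin h} (hm : m.head i = 0) :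
    Exec (eachHead i p) v m (setTok v false) m 1 := by
  have hx : m.stk (.head i) = List.replicate 0 () := congrArg (List.replicate · ()) hm
  refine runs_loop_exit (k := (.head i : Stk h)) (by rw [hx]; rfl) ?_ rfl
  rw [hx]
  exact (m.update_head i 0).trans (by rw [← hm, Function.update_eq_self])

theorem eachHead_step {i : Fin h} {n : ℕ} (hm : m.head i = n + 1)
    (hp : Exec p (setTok v true) { m with head := Function.update m.head i n } v' m' t)
    (hl : Exec (eachHead i p) v' m' v'' m'' t') :
    Exec (eachHead i p) v m v'' m'' (1 + t + t') := by
  have hx : m.stk (.head i) = List.replicate (n + 1) () := congrArg (List.replicate · ()) hm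
  exact Runs.loop (k := (.head i : Stk h)) (v₁ := setTok v true) (by rw [hx]; rfl)
    (by rw [hx]; exact m.update_head i n) rfl hp hl

end Loops
end Prg
end InPlace

/-! ### Building the simulated tape and the clock -/

namespace InPlace

open Turing

namespace Prg

open StackProg

variable {h : ℕ} {α S : Type}

def cellD (v : Var α S) : Cell := v.cell.getD default

/-- Move the tape from the left stack to the right stack. -/
def unwind : Prg h α S := eachLeft (pushRight cellD)

/-- Move the tape from the right stack to the left stack. -/
def rewind : Prg h α S := eachRight (pushLeft cellD)

theorem exec_unwind (l : List Cell) (v : Var α S) (m : Mem h α) (hm : m.left = l) :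
    Exec unwind v m (setCell v none) { m with left := [], right := l.reverse ++ m.right }
      (2 * l.length + 1) := by
  induction l generalizing v m with
  | nil => exact (eachLeft_exit hm).cast rfl (by cases m; simp_all) (by simp)
  | cons x l ih =>
    exact (eachLeft_step hm (exec_pushRight _ _ _) (ih _ _ rfl)).cast rfl (by simp [cellD, setCell])
      (by simp; omega)

theorem exec_rewind (l : List Cell) (v : Var α S) (m : Mem h α) (hm : m.right = l) :
    Exec rewind v m (setCell v none) { m with right := [], left := l.reverse ++ m.left }
      (2 * l.length + 1) := by
  induction l generalizing v m with
  | nil => exact (eachRight_exit hm).cast rfl (by cases m; simp_all) (by simp)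
  | cons x l ih =>
    exact (eachRight_step hm (exec_pushLeft _ _ _) (ih _ _ rfl)).cast rfl (by simp [cellD, setCell])
      (by simp; omega)

/-- Repeat a program. -/
def rep : ℕ → Prg h α S → Prg h α S
  | 0, _ => skip
  | n + 1, p => .seq p (rep n p)

/-! Reading the input. -/

def bitD (toSym : α → Option Bool) (v : Var α S) : Bool := (v.inb.bind toSym).getD false

/-- Read bits from the input and push them as cells. -/
def parse (toSym : α → Option Bool) (κ : Bool → Option Bool) (e : Prg h α S) : Prg h α S :=
  eachInp (fun x => (toSym x).isSome)
    (.seq (pushRight fun v => (bitD toSym v, κ (bitD toSym v))) e)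

/-- The bits `u` are followed by `r`, which is empty or starts with a non-bit; that symbol stops the
loop and is lost, hence `r.tail`. The hook `e` adds `δ` to the first counter per bit: it measures
the input (`δ = 1`) or does nothing (`δ = 0`). -/
theorem exec_parse (toSym : α → Option Bool) (κ : Bool → Option Bool) (e : Prg h α S) (δ : ℕ)
    (he : ∀ v m, Exec e v m v { m with a := m.a + δ } 1) (r : List α)
    (hr : r.head?.any (fun x => (toSym x).isSome) = false)
    (u : List α) (y : List Bool) (hu : u.map toSym = y.map some)
    (v : Var α S) (m : Mem h α) (hm : m.inp = u ++ r) :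
    Exec (parse toSym κ e) v m (setInb v r.head?)
      { m with inp := r.tail, right := (y.map fun b => (b, κ b)).reverse ++ m.right,
               a := m.a + δ * y.length } (3 * y.length + 1) := by
  induction u generalizing v m y with
  | nil =>
    have hy : y = [] := by simpa using hu.symm
    subst hy
    have hm' : m.inp = r := hm
    subst hm'
    exact (eachInp_exit hr).cast rfl (by simp) (by simp)
  | cons x u ih =>
    cases y with
    | nil => simp at hu
    | cons b y =>
      simp only [List.map_cons, List.cons.injEq] at hu
      have hb : ∀ v : Var α S, bitD toSym (setInb v (some x)) = b := by
        intro v; simp [bitD, setInb, hu.1]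
      refine (eachInp_step hm (by simp [hu.1]) ((exec_pushRight _ _ _).seq (he _ _))
        (ih y hu.2 _ _ rfl)).cast rfl ?_ (by simp; omega)
      simp only [hb, List.map_cons, List.reverse_cons, List.append_assoc, List.length_cons,
        List.cons_append, List.nil_append, Mem.mk.injEq, true_and, and_true]
      ring

/-! The logarithm. -/

def setPar (v : Var α S) (b : Bool) : Var α S := { v with par := b }

def halveLoop : Prg h α S :=
  eachA (.seq (.ite (fun v => v.par) pushB skip) (.load fun v => setPar v !v.par))

/-- Each unit toggles `par` and is copied only if the flag was set, so the initial flag decides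
between rounding up and down. The final flag is left open because `halve` resets it. -/
theorem exec_halveLoop (n : ℕ) (v : Var α S) (m : Mem h α) (hm : m.a = n) :
    ∃ b, Exec halveLoop v m (setPar (setTok v false) b)
      { m with a := 0, b := m.b + (if v.par then (n + 1) / 2 else n / 2) } (4 * n + 1) := by
  induction n generalizing v m with
  | zero => exact ⟨v.par, (eachA_exit hm).cast rfl (by cases m; simp_all) (by simp)⟩
  | succ n ih =>
    cases hv : v.par with
    | true =>
      obtain ⟨b, hb⟩ := ih (setPar (setTok v true) false) { m with a := n, b := m.b + 1 } rfl
      refine ⟨b, (eachA_step hm (v' := setPar (setTok v true) false) (t := 3) ?_ hb).cast rfl ?_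
        (by omega)⟩
      · refine ((Exec.ite_true (v := setTok v true) hv (exec_pushB _ _)).seq
          (exec_load _ _ _)).cast ?_ rfl le_rfl
        simp [setPar, setTok, hv]
      · simp [setPar]; omega
    | false =>
      obtain ⟨b, hb⟩ := ih (setPar (setTok v true) true) { m with a := n } rfl
      refine ⟨b, (eachA_step hm (v' := setPar (setTok v true) true) (t := 3) ?_ hb).cast rfl ?_
        (by omega)⟩
      · refine ((Exec.ite_false (v := setTok v true) hv (exec_skip _ _)).seq
          (exec_load _ _ _)).cast ?_ rfl le_rfl
        simp [setPar, setTok, hv]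
      · simp [setPar]

/-- Replace the number `n` in the first counter by `(n + 1) / 2`, in the second counter. -/
def halve : Prg h α S :=
  .seq (.load fun v => setPar v true) (.seq halveLoop (.load fun v => setPar v false))

theorem exec_halve (v : Var α S) (m : Mem h α) (hv : v.par = false) :
    Exec halve v m (setTok v false) { m with a := 0, b := m.b + (m.a + 1) / 2 }
      (4 * m.a + 3) := by
  obtain ⟨b, hb⟩ := exec_halveLoop m.a (setPar v true) m rfl
  exact ((exec_load _ _ _).seq (hb.seq (exec_load _ _ _))).cast
    (by simp [setPar, setTok, ← hv]) (by simp [setPar]) (by omega)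

/-- Move the second counter to the first counter. -/
def moveBA : Prg h α S := eachB pushA

theorem exec_moveBA (n : ℕ) (v : Var α S) (m : Mem h α) (hm : m.b = n) :
    Exec moveBA v m (setTok v false) { m with a := m.a + n, b := 0 } (2 * n + 1) := by
  induction n generalizing v m with
  | zero => exact (eachB_exit hm).cast rfl (by cases m; simp_all) (by simp)
  | succ n ih =>
    exact (eachB_step hm (exec_pushA _ _) (ih _ _ rfl)).cast rfl (by simp; ring) (by omega)

/-- Push `k` cells of the additional work space. -/
def pad (k : ℕ) : Prg h α S := rep k (pushRight fun _ => (true, some false))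

theorem exec_pad (k : ℕ) (v : Var α S) (m : Mem h α) :
    Exec (pad k) v m v { m with right := List.replicate k (true, some false) ++ m.right }
      (k + 1) := by
  induction k generalizing m with
  | zero => exact exec_skip v m
  | succ k ih =>
    refine ((exec_pushRight _ _ _).seq (ih _)).cast rfl ?_ (by omega)
    simp [List.replicate_succ']

/-- Push `k ⌈log₂ (n + 1)⌉` cells of the additional work space, where `n` is the number in the
first counter. -/
def padLog (k : ℕ) : Prg h α S := eachA (.seq halve (.seq moveBA (pad k)))

/-- If `m` is the counter plus one, a round replaces `m` by its half rounded up, which is the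
recursion of `Nat.clog`, and the loop ends at `m = 1`. The quadratic time bound is crude but
sufficient. -/
theorem exec_padLog (k n : ℕ) (v : Var α S) (m : Mem h α) (hv : v.par = false) (ha : m.a = n)
    (hb : m.b = 0) :
    Exec (padLog k) v m (setTok v false)
      { m with a := 0,
               right := List.replicate (k * Nat.clog 2 (n + 1)) (true, some false) ++ m.right }
      (n * (7 * n + k + 8) + 1) := by
  induction n using Nat.strong_induction_on generalizing v m with
  | _ n ih =>
    cases n with
    | zero => exact (eachA_exit ha).cast rfl (by cases m; simp_all) (by simp)
    | succ n =>
      have h1 := exec_halve (setTok v true) { m with a := n } hv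
      have h2 := exec_moveBA ((n + 1) / 2) (setTok v false)
        { m with a := 0, b := (n + 1) / 2 } rfl
      have h3 := exec_pad k (setTok v false) { m with a := (n + 1) / 2, b := 0 }
      have h4 := ih ((n + 1) / 2) (by omega) (setTok v false)
        { m with a := (n + 1) / 2, b := 0,
                 right := List.replicate k (true, some false) ++ m.right } hv rfl rfl
      have hlog : Nat.clog 2 (n + 1 + 1) = Nat.clog 2 ((n + 1) / 2 + 1) + 1 := by
        rw [Nat.clog_of_two_le one_lt_two (by omega)]
        congr 2
        omega
      refine (eachA_step ha ((h1.cast rfl (by simp [hb]) le_rfl).seq ((h2.cast rfl (by simp)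
        le_rfl).seq h3)) h4).cast rfl ?_ ?_
      · simp only [hlog, mul_add, mul_one, ← List.append_assoc, List.replicate_append_replicate,
          hb]
      · have h5 : (n + 1) / 2 * (7 * ((n + 1) / 2) + k + 8) ≤ n * (7 * n + k + 8) := by
          have : (n + 1) / 2 ≤ n := by omega
          gcongr
        have h6 : 2 * ((n + 1) / 2) ≤ n + 1 := by omega
        simp only
        nlinarith

/-! The clock. -/

def countCells : Prg h α S := eachLeft (.seq (pushRight cellD) pushB)

theorem exec_countCells (l : List Cell) (v : Var α S) (m : Mem h α) (hm : m.left = l) :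
    Exec countCells v m (setCell v none)
      { m with left := [], right := l.reverse ++ m.right, b := m.b + l.length }
      (3 * l.length + 1) := by
  induction l generalizing v m with
  | nil => exact (eachLeft_exit hm).cast rfl (by cases m; simp_all) (by simp)
  | cons x l ih =>
    exact (eachLeft_step hm ((exec_pushRight _ _ _).seq (exec_pushB _ _)) (ih _ _ rfl)).cast rfl
      (by simp [cellD, setCell]; ring) (by simp; omega)

def mulLoop : Prg h α S := eachA (.seq countCells (.seq rewind (.seq pushB pushB)))

/-- Every round counts the cells by carrying the tape to the other stack and back; the two extra
units stand for the end markers. -/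
theorem exec_mulLoop (n : ℕ) (v : Var α S) (m : Mem h α) (hv : v.cell = none)
    (hr : m.right = []) (ha : m.a = n) :
    Exec mulLoop v m (setTok v false) { m with a := 0, b := m.b + n * (m.left.length + 2) }
      (n * (5 * m.left.length + 5) + 1) := by
  induction n generalizing v m with
  | zero => exact (eachA_exit ha).cast rfl (by cases m; simp_all) (by simp)
  | succ n ih =>
    have h1 := exec_countCells m.left (setTok v true) { m with a := n } rfl
    have h2 := exec_rewind m.left.reverse (setTok (setCell v none) true)
      { m with a := n, left := [], right := m.left.reverse, b := m.b + m.left.length } rfl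
    refine (eachA_step ha ((h1.cast rfl (by simp [hr]) le_rfl).seq ((h2.cast rfl (by simp; rfl)
      le_rfl).seq ((exec_pushB _ _).seq (exec_pushB _ _)))) (ih _ _ rfl rfl rfl)).cast ?_ ?_ ?_
    · simp [setTok, setCell, ← hv]
    · simp [hr]; ring
    · simp; nlinarith

/-- Multiply the first counter by the number of positions of the tape. -/
def mulStep : Prg h α S := .seq mulLoop moveBA

theorem exec_mulStep (v : Var α S) (m : Mem h α) (hv : v.cell = none)
    (hr : m.right = []) (hb : m.b = 0) :
    Exec mulStep v m (setTok v false) { m with a := m.a * (m.left.length + 2) }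
      (7 * (m.a * (m.left.length + 2)) + 2) := by
  refine ((exec_mulLoop _ v m hv hr rfl).seq (exec_moveBA _ _ _ rfl)).cast rfl ?_ ?_
  · simp [hb]
  · simp only [hb]; nlinarith

theorem exec_rep_mulStep (d : ℕ) (v : Var α S) (m : Mem h α) (hv : v.cell = none)
    (ht : v.tok = false) (hr : m.right = []) (hb : m.b = 0) :
    Exec (rep d mulStep) v m v { m with a := m.a * (m.left.length + 2) ^ d }
      (d * (7 * (m.a * (m.left.length + 2) ^ d) + 2) + 1) := by
  induction d generalizing m with
  | zero => exact (exec_skip v m).cast rfl (by simp) (by simp)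
  | succ d ih =>
    have hv' : setTok v false = v := by simp [setTok, ← ht]
    have h1 := exec_mulStep v m hv hr hb
    rw [hv'] at h1
    refine (h1.seq (ih { m with a := m.a * (m.left.length + 2) } hr hb)).cast rfl ?_ ?_
    · simp; ring
    · simp only
      have h2 : m.a * (m.left.length + 2) ≤ m.a * (m.left.length + 2) ^ (d + 1) := by
        gcongr
        exact Nat.le_self_pow (by omega) _
      have h3 : m.a * (m.left.length + 2) * (m.left.length + 2) ^ d =
        m.a * (m.left.length + 2) ^ (d + 1) := by ring
      rw [h3]
      nlinarith

/-- Set the first counter to the `d`-th power of the number of positions of the tape. -/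
def clock (d : ℕ) : Prg h α S := .seq pushA (rep d mulStep)

theorem exec_clock (d : ℕ) (v : Var α S) (m : Mem h α) (hv : v.cell = none)
    (ht : v.tok = false) (hr : m.right = []) (ha : m.a = 0) (hb : m.b = 0) :
    Exec (clock d) v m v { m with a := (m.left.length + 2) ^ d }
      (d * (7 * (m.left.length + 2) ^ d + 2) + 2) := by
  refine ((exec_pushA _ _).seq (exec_rep_mulStep d v _ hv ht ?_ ?_)).cast rfl ?_ ?_
  · exact hr
  · exact hb
  · simp [ha]
  · simp [ha]; omega

end Prg
end InPlace

/-! ### Machine steps without halting, and their simulation on stacks -/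

namespace InPlace

open Turing

namespace Scan

/-- The bit that has to be written to leave a scanned symbol unchanged. -/
def toBit : Scan → Bool
  | bit b => b
  | _ => false

end Scan

namespace Machine

variable (M : Machine)

/-- The action of the machine; a halting machine does nothing. -/
def act (q : M.State) (s : Scan) : M.State × Bool × Move :=
  (M.trans q s).getD (q, s.toBit, .stay)

/-- The next configuration; a halting configuration is repeated. -/
def next (C : Cfg M) : Cfg M := (M.step C).getD C

/-- At an end marker the value of `toBit` is arbitrary, which is harmless because nothing is written
there. -/
theorem write_scan_toBit (tape : List Bool) (p : ℕ) : write tape (scan tape p).toBit p = tape := by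
  cases p with
  | zero => rfl
  | succ p =>
    rcases lt_or_ge p tape.length with hp | hp
    · simp [write, scan, hp, Scan.toBit]
    · simp [write, List.set_eq_of_length_le hp]

/-- Reading a halt as an action that changes nothing gives one formula for all configurations, so
the simulation need not detect halting. -/
theorem next_eq (C : Cfg M) : M.next C =
    { state := (M.act C.state (scan C.tape (C.pos (M.active C.state)))).1
      tape := write C.tape (M.act C.state (scan C.tape (C.pos (M.active C.state)))).2.1
        (C.pos (M.active C.state))
      pos := Function.update C.pos (M.active C.state)
        ((M.act C.state (scan C.tape (C.pos (M.active C.state)))).2.2.apply C.tape.length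
          (C.pos (M.active C.state))) } := by
  cases ht : M.trans C.state (scan C.tape (C.pos (M.active C.state))) with
  | none => simp [next, step, act, ht, write_scan_toBit, Move.apply]
  | some a => simp [next, step, act, ht]

end Machine

theorem length_write (tape : List Bool) (b : Bool) (p : ℕ) :
    (write tape b p).length = tape.length := by
  cases p <;> simp [write]

theorem Move.apply_le {N p : ℕ} (hp : p ≤ N + 1) (mv : Move) : mv.apply N p ≤ N + 1 := by
  cases mv <;> simp [Move.apply] <;> omega

/-- Every head is on the tape or on an end marker. -/
def Cfg.Bounded {M : Machine} (C : Cfg M) : Prop := ∀ i, C.pos i ≤ C.tape.length + 1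

theorem Cfg.Bounded.next {M : Machine} {C : Cfg M} (hC : C.Bounded) : (M.next C).Bounded := by
  intro i
  rw [Machine.next_eq]
  simp only [length_write]
  by_cases hi : i = M.active C.state
  · subst hi
    simpa using Move.apply_le (hC _) _
  · simpa [hi] using hC i

theorem Machine.length_next (M : Machine) (C : Cfg M) :
    (M.next C).tape.length = C.tape.length := by
  rw [Machine.next_eq]; exact length_write _ _ _

/-- How much the position of a head is after a move, compared with the predecessor of the old
position. -/
def Move.count : Move → Scan → Fin 3
  | right, .leftEnd => 1
  | _, .leftEnd => 0
  | left, .bit _ => 0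
  | stay, .bit _ => 1
  | right, .bit _ => 2
  | left, .rightEnd => 0
  | _, .rightEnd => 1

theorem scan_succ_of_lt {tape : List Bool} {p : ℕ} (hp : p < tape.length) :
    scan tape (p + 1) = .bit tape[p] := by
  simp [scan, hp]

theorem scan_succ_of_le {tape : List Bool} {p : ℕ} (hp : tape.length ≤ p) :
    scan tape (p + 1) = .rightEnd := by
  simp [scan, hp]

/-- Positions are unary counters, and testing one against zero pops a unit if there is one. The
formula starts from this popped value and adds back zero to two units; truncated subtraction is
intended. -/
theorem Move.apply_eq {tape : List Bool} {p : ℕ} (hp : p ≤ tape.length + 1) (mv : Move) :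
    mv.apply tape.length p = p - 1 + mv.count (scan tape p) := by
  cases p with
  | zero => cases mv <;> simp [Move.apply, scan, Move.count]
  | succ p =>
    rcases lt_or_ge p tape.length with hp' | hp'
    · rw [scan_succ_of_lt hp']
      cases mv <;> simp [Move.apply, Move.count]
      omega
    · rw [scan_succ_of_le hp']
      cases mv <;> simp [Move.apply, Move.count]
      omega

namespace Prg

open StackProg

variable {h : ℕ} {α S : Type}

/-! One step of the simulated machine. -/

def clearCell : Prg h α S := .load fun v => setCell v none

/-- Move the tape such that the cell after the position of head `i` is on top of the left stack. -/
def getHead (i : Fin h) : Prg h α S :=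
  eachHead i (.seq pushB (.seq popLeft (.seq (pushRight cellD) clearCell)))

/-- At rest the whole tape is on the left stack, first cell on top. The cells in front of the head
pass to the right stack, and the second counter remembers how many, since the head counter is used
up. -/
theorem exec_getHead (i : Fin h) (l r : List Cell) (v : Var α S) (m : Mem h α)
    (hv : v.cell = none) (hi : m.head i = l.length) (hl : m.left = l ++ r) :
    Exec (getHead i) v m (setTok v false)
      { m with left := r, right := l.reverse ++ m.right, b := m.b + l.length,
               head := Function.update m.head i 0 } (5 * l.length + 1) := by
  induction l generalizing v m with
  | nil =>
    have hi' : m.head i = 0 := hi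
    have hl' : m.left = r := hl
    refine (eachHead_exit hi).cast rfl ?_ (by simp)
    rw [← hi', ← hl']
    simp
  | cons x l ih =>
    refine (eachHead_step hi ((exec_pushB _ _).seq ((exec_popLeft _ _).seq
      ((exec_pushRight _ _ _).seq (exec_load _ _ _)))) (ih _ _ rfl ?_ ?_)).cast ?_ ?_ ?_
    · simp
    · simp [hl]
    · simp [setTok, setCell, hv]
    · simp [hl, cellD, setCell]; omega
    · simp; omega

/-- The converse of `getHead`. -/
def setHead (i : Fin h) : Prg h α S :=
  eachB (.seq (pushHead i) (.seq popRight (.seq (pushLeft cellD) clearCell)))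

theorem exec_setHead (i : Fin h) (l : List Cell) (v : Var α S) (m : Mem h α)
    (hv : v.cell = none) (hb : m.b = l.length) (hl : m.right = l) :
    Exec (setHead i) v m (setTok v false)
      { m with left := l.reverse ++ m.left, right := [], b := 0,
               head := Function.update m.head i (m.head i + l.length) } (5 * l.length + 1) := by
  induction l generalizing v m with
  | nil =>
    refine (eachB_exit hb).cast rfl ?_ (by simp)
    cases m; simp_all
  | cons x l ih =>
    refine (eachB_step hb ((exec_pushHead _ _ i).seq ((exec_popRight _ _).seq
      ((exec_pushLeft _ _ _).seq (exec_load _ _ _)))) (ih _ _ rfl rfl ?_)).cast ?_ ?_ ?_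
    · simp [hl]
    · simp [setTok, setCell, hv]
    · simp [hl, cellD, setCell]; congr 1; omega
    · simp; omega

/-- An empty pop means that the head is beyond the last cell. The left end marker is the default
value of `sym`, which stays in place when the position is zero. -/
def scanCell (v : Var α S) : Var α S :=
  { v with sym := v.cell.elim .rightEnd fun c => .bit c.1 }

/-- At an end marker `cell` is `none` and the `map` writes nothing; the requirement attached to a
cell never changes. -/
def actVar (M : Machine) (v : Var α M.State) : Var α M.State :=
  { v with state := (M.act v.state v.sym).1
           cell := v.cell.map fun c => ((M.act v.state v.sym).2.1, c.2)
           cnt := (M.act v.state v.sym).2.2.count v.sym }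

def putCell : Prg h α S := .ite (fun v => v.cell.isSome) (.seq (pushLeft cellD) clearCell) skip

theorem exec_putCell (v : Var α S) (m : Mem h α) :
    Exec putCell v m (setCell v none) { m with left := v.cell.toList ++ m.left } 3 := by
  cases hc : v.cell with
  | none =>
    exact (Exec.ite_false (by simp [hc]) (exec_skip _ _)).cast (by simp [setCell, ← hc])
      (by simp) (by omega)
  | some c =>
    exact (Exec.ite_true (by simp [hc]) ((exec_pushLeft _ _ _).seq (exec_load _ _ _))).cast
      rfl (by simp [cellD, hc]) (by omega)

def pushCount (i : Fin h) : Prg h α S :=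
  .seq (.ite (fun v => decide (1 ≤ v.cnt.val)) (pushHead i) skip)
    (.ite (fun v => decide (2 ≤ v.cnt.val)) (pushHead i) skip)

theorem exec_pushCount (i : Fin h) (v : Var α S) (m : Mem h α) :
    Exec (pushCount i) v m v
      { m with head := Function.update m.head i (m.head i + v.cnt) } 4 := by
  obtain hc | hc | hc : v.cnt.val = 0 ∨ v.cnt.val = 1 ∨ v.cnt.val = 2 := by omega
  · exact ((Exec.ite_false (by simp [hc]) (exec_skip _ _)).seq
      (Exec.ite_false (by simp [hc]) (exec_skip _ _))).cast rfl (by simp [hc]) (by omega)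
  · exact ((Exec.ite_true (by simp [hc]) (exec_pushHead _ _ _)).seq
      (Exec.ite_false (by simp [hc]) (exec_skip _ _))).cast rfl (by simp [hc]) (by omega)
  · exact ((Exec.ite_true (by simp [hc]) (exec_pushHead _ _ _)).seq
      (Exec.ite_true (by simp [hc]) (exec_pushHead _ _ _))).cast rfl (by simp [hc]) (by omega)

def readHead (i : Fin h) : Prg h α S :=
  .seq (popHead i) (.ite (fun v => v.tok) (.seq (getHead i) (.seq popLeft (.load scanCell))) skip)

/-- Popping the head counter detects the left end marker and otherwise leaves exactly the number of
cells in front of the head. -/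
theorem exec_readHead (i : Fin h) (tape : List Bool) (κ : List (Option Bool))
    (v : Var α S) (m : Mem h α) (hκ : κ.length = tape.length) (hv : v.cell = none)
    (hs : v.sym = .leftEnd) (ht : v.tok = false) (hr : m.right = []) (hb : m.b = 0)
    (hl : m.left = tape.zip κ) (hi : m.head i ≤ tape.length + 1) :
    Exec (readHead i) v m
      { v with sym := scan tape (m.head i),
               cell := if m.head i = 0 then none else (tape.zip κ)[m.head i - 1]? }
      { m with left := if m.head i = 0 then tape.zip κ else (tape.zip κ).drop (m.head i)
               right := ((tape.zip κ).take (m.head i - 1)).reverse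
               b := m.head i - 1
               head := Function.update m.head i 0 } (5 * tape.length + 6) := by
  have h1 := exec_popHead v m i
  cases hp : m.head i with
  | zero =>
    rw [hp] at h1
    refine (h1.seq (Exec.ite_false rfl (exec_skip _ _))).cast ?_ ?_ (by omega)
    · simp [setTok, ← ht, ← hv, ← hs, scan]
    · have hu : Function.update m.head i 0 = m.head := by rw [← hp, Function.update_eq_self]
      simp [hl, hr, hb, hu]
  | succ p =>
    rw [hp] at h1
    have hlen : ((tape.zip κ).take p).length = p := by simp [hκ]; omega
    refine (h1.seq (Exec.ite_true rfl ((exec_getHead i ((tape.zip κ).take p)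
      ((tape.zip κ).drop p) (setTok v true) _ hv ?_ ?_).seq
        ((exec_popLeft _ _).seq (exec_load _ _ _))))).cast ?_ ?_ ?_
    · simp [hlen]
    · simp [hl]
    · simp only [scanCell, setCell, setTok, List.head?_drop, Nat.add_one_ne_zero, if_false,
        Nat.add_sub_cancel]
      rcases lt_or_ge p tape.length with hp' | hp'
      · rw [scan_succ_of_lt hp', List.getElem?_eq_getElem (by simp [hκ, hp'])]
        simp [ht]
      · rw [scan_succ_of_le hp', List.getElem?_eq_none (by simp [hp'])]
        simp [ht]
    · simp [hlen, hr, hb]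
    · rw [hlen]; omega

/-- One step of the machine `M`, when head `i` is active. -/
def stepAt (M : Machine) (i : Fin M.headCount) : Prg M.headCount α M.State :=
  .seq (readHead i) (.seq (.load (actVar M)) (.seq putCell (.seq (setHead i)
    (.seq (pushCount i) (.load fun v => { v with sym := .leftEnd, cnt := 0 })))))

theorem exec_stepAt (M : Machine) (C : Cfg M) (κ : List (Option Bool))
    (v : Var α M.State) (m : Mem M.headCount α) (hκ : κ.length = C.tape.length)
    (hC : C.Bounded) (hv : v = { state := C.state, found := v.found })
    (hr : m.right = []) (hb : m.b = 0) (hl : m.left = C.tape.zip κ) (hp : m.head = C.pos) :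
    Exec (stepAt M (M.active C.state)) v m { v with state := (M.next C).state }
      { m with left := (M.next C).tape.zip κ, head := (M.next C).pos }
      (10 * C.tape.length + 16) := by
  set i := M.active C.state with hi
  have hpi : m.head i = C.pos i := by rw [hp]
  have h1 := exec_readHead i C.tape κ v m hκ (by rw [hv]) (by rw [hv]) (by rw [hv]) hr hb hl
    (by rw [hpi]; exact hC i)
  rw [hpi] at h1
  set w := C.tape.zip κ with hw
  set a := M.act C.state (scan C.tape (C.pos i)) with ha
  have hlen : (w.take (C.pos i - 1)).length = C.pos i - 1 := by
    have := hC i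
    simp [hw, hκ]; omega
  refine (h1.seq ((exec_load _ _ _).seq ((exec_putCell _ _).seq
    ((exec_setHead i (w.take (C.pos i - 1)).reverse _ _ rfl ?_ rfl).seq
      ((exec_pushCount _ _ _).seq (exec_load _ _ _)))))).cast ?_ ?_ ?_
  · simp only [List.length_reverse, hlen]
  · rw [M.next_eq, hv]
    simp [setTok, setCell, actVar, hi]
  · rw [M.next_eq, ← hi, ← ha]
    have hst : v.state = C.state := by rw [hv]
    have hpos : C.pos i - 1 + (a.2.2.count (scan C.tape (C.pos i))).val =
        a.2.2.apply C.tape.length (C.pos i) := (Move.apply_eq (hC i) _).symm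
    -- The cells in front of the head, the rewritten cell and the cells behind it glue to the
    -- written tape; at either marker there is no cell to rewrite.
    have htape : w.take (C.pos i - 1) ++ ((if C.pos i = 0 then none else w[C.pos i - 1]?).map
        fun c => (a.2.1, c.2)).toList ++ (if C.pos i = 0 then w else w.drop (C.pos i)) =
        (write C.tape a.2.1 (C.pos i)).zip κ := by
      cases hq : C.pos i with
      | zero => simp [write, hw]
      | succ p =>
        simp only [Nat.add_one_ne_zero, if_false, Nat.add_sub_cancel, write]
        rcases lt_or_ge p C.tape.length with hp' | hp'
        · rw [List.getElem?_eq_getElem (by simp [hw, hκ, hp'])]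
          have h2 := List.set_eq_take_append_cons_drop (l := w) (i := p)
            (a := (a.2.1, w[p]'(by simp [hw, hκ, hp']) |>.2))
          rw [if_pos (by simp [hw, hκ, hp'])] at h2
          simp only [Option.map_some, Option.toList_some, List.append_assoc, List.singleton_append]
          rw [← h2]
          refine List.ext_getElem (by simp [hw]) fun j hj hj' => ?_
          by_cases hjp : p = j
          · subst hjp; simp [hw]
          · simp [hw, hjp]
        · rw [List.getElem?_eq_none (by simp [hw, hp']), List.set_eq_of_length_le hp']
          rw [List.take_of_length_le (by simp [hw, hp']),
            List.drop_eq_nil_of_le (by simp [hw]; omega)]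
          simp [hw]
    simp only [actVar, setCell, setTok, hst, ← ha, List.reverse_reverse, List.length_reverse, hlen,
      Function.update_self, Function.update_idem, zero_add, hpos, hb, hr, hp, ← htape,
      List.append_assoc]
  · simp only [List.length_reverse, hlen]
    have := hC i
    omega

end Prg
end InPlace

/-! ### Clocked search for an accepted configuration, and the output -/

namespace InPlace

open Turing

/-- The tape matches the requirements `κ` and the state is `g`. -/
noncomputable def Cfg.accepts {M : Machine} (g : M.State) (κ : List (Option Bool)) (C : Cfg M) :
    Bool :=
  open scoped Classical in
  (C.tape.zip κ).all (fun c => c.2.all (· == c.1)) && decide (C.state = g)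

/-- One step of the search: an accepted configuration is kept. -/
noncomputable def Cfg.searchStep {M : Machine} (g : M.State) (κ : List (Option Bool))
    (C : Cfg M) : Cfg M :=
  if C.accepts g κ then C else M.next C

theorem Cfg.length_searchStep {M : Machine} (g : M.State) (κ : List (Option Bool)) (C : Cfg M) :
    (C.searchStep g κ).tape.length = C.tape.length := by
  unfold searchStep
  split
  · rfl
  · exact M.length_next C

theorem Cfg.Bounded.searchStep {M : Machine} {g : M.State} {κ : List (Option Bool)} {C : Cfg M}
    (hC : C.Bounded) : (C.searchStep g κ).Bounded := by
  unfold Cfg.searchStep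
  split
  · exact hC
  · exact hC.next

theorem Cfg.iterate_searchStep {M : Machine} {g : M.State} {κ : List (Option Bool)} {C : Cfg M}
    (hC : C.Bounded) (n : ℕ) : ((Cfg.searchStep g κ)^[n] C).Bounded ∧
      ((Cfg.searchStep g κ)^[n] C).tape.length = C.tape.length := by
  induction n generalizing C with
  | zero => exact ⟨hC, rfl⟩
  | succ n ih =>
    rw [Function.iterate_succ_apply]
    exact (ih hC.searchStep).imp_right fun h => h.trans (C.length_searchStep g κ)

namespace Prg

open StackProg

variable {h : ℕ} {α S : Type}

/-- One step of the machine `M`. -/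
def machineStep (M : Machine) : Prg M.headCount α M.State :=
  .switch M.headCount (fun v => M.active v.state) (stepAt M)

def setFound (v : Var α S) (b : Bool) : Var α S := { v with found := b }

def checkLoop : Prg h α S :=
  eachLeft (.seq (.load fun v =>
    setFound v (v.found && (cellD v).2.all (· == (cellD v).1))) (pushRight cellD))

theorem exec_checkLoop (l : List Cell) (v : Var α S) (m : Mem h α) (hm : m.left = l) :
    Exec checkLoop v m (setFound (setCell v none) (v.found && l.all fun c => c.2.all (· == c.1)))
      { m with left := [], right := l.reverse ++ m.right } (3 * l.length + 1) := by
  induction l generalizing v m with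
  | nil =>
    refine (eachLeft_exit hm).cast ?_ ?_ (by simp)
    · simp [setCell, setFound]
    · cases m; simp_all
  | cons x l ih =>
    refine (eachLeft_step hm ((exec_load _ _ _).seq (exec_pushRight _ _ _)) (ih _ _ rfl)).cast
      ?_ ?_ ?_
    · simp [cellD, setCell, setFound, Bool.and_assoc]
    · simp [cellD, setCell, setFound]
    · simp; omega

/-- Check whether the configuration is accepted. -/
noncomputable def check (g : S) : Prg h α S :=
  open scoped Classical in
  .seq (.load fun v => setFound v true) (.seq checkLoop (.seq rewind
    (.load fun v => setFound v (v.found && decide (v.state = g)))))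

theorem exec_check {M : Machine} (g : M.State) (κ : List (Option Bool)) (C : Cfg M)
    (v : Var α M.State) (m : Mem h α) (hv : v.cell = none) (hs : v.state = C.state)
    (hl : m.left = C.tape.zip κ) (hr : m.right = []) :
    Exec (check g) v m (setFound v (C.accepts g κ)) m (5 * C.tape.length + 4) := by
  have hlen : (C.tape.zip κ).length ≤ C.tape.length := by simp
  refine ((exec_load _ _ _).seq ((exec_checkLoop (C.tape.zip κ) _ _ hl).seq
    ((exec_rewind (C.tape.zip κ).reverse _ _ ?_).seq (exec_load _ _ _)))).cast ?_ ?_ ?_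
  · simp [hr]
  · cases v
    dsimp only at hv hs
    subst hv hs
    simp only [setFound, setCell, Cfg.accepts, Bool.true_and]
    congr
  · cases m; simp_all
  · rw [List.length_reverse]; omega

noncomputable def searchBody (M : Machine) (g : M.State) : Prg M.headCount α M.State :=
  .seq (check g) (.ite (fun v => v.found) skip
    (.seq (.load fun v => setTok v false) (machineStep M)))

/-- The two flags left behind do not influence the next round, hence the existential quantifiers. -/
theorem exec_searchBody {M : Machine} (g : M.State) (κ : List (Option Bool)) (C : Cfg M)
    (b b' : Bool) (m : Mem M.headCount α) (hκ : κ.length = C.tape.length) (hC : C.Bounded)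
    (hr : m.right = []) (hb : m.b = 0) (hl : m.left = C.tape.zip κ) (hp : m.head = C.pos) :
    ∃ c c', Exec (searchBody M g) { state := C.state, found := b, tok := b' } m
      { state := (C.searchStep g κ).state, found := c, tok := c' }
      { m with left := (C.searchStep g κ).tape.zip κ, head := (C.searchStep g κ).pos }
      (15 * C.tape.length + 23) := by
  have h1 := exec_check g κ C { state := C.state, found := b, tok := b' } m rfl rfl hl hr
  unfold Cfg.searchStep
  cases hf : C.accepts g κ with
  | true =>
    rw [hf] at h1
    refine ⟨true, b', (h1.seq (Exec.ite_true rfl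
      (exec_skip _ _))).cast ?_ ?_ (by omega)⟩
    · simp [setFound]
    · simp [← hl, ← hp]
  | false =>
    rw [hf] at h1
    refine ⟨false, false, (h1.seq (Exec.ite_false rfl
      ((exec_load _ _ _).seq (Exec.switch (f := fun v => M.active v.state) (p := stepAt M)
        (exec_stepAt M C κ { state := C.state, found := false } m hκ hC rfl hr hb hl hp))))).cast
          ?_ ?_ ?_⟩
    · simp
    · simp
    · omega

/-- Search, where the first counter bounds the number of steps. -/
noncomputable def search (M : Machine) (g : M.State) : Prg M.headCount α M.State :=
  .seq (eachA (searchBody M g)) (check g)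

theorem exec_searchLoop {M : Machine} (g : M.State) (κ : List (Option Bool)) (n : ℕ) (C : Cfg M)
    (b b' : Bool) (m : Mem M.headCount α) (hκ : κ.length = C.tape.length) (hC : C.Bounded)
    (ha : m.a = n)
    (hr : m.right = []) (hb : m.b = 0) (hl : m.left = C.tape.zip κ) (hp : m.head = C.pos) :
    ∃ c, Exec (eachA (searchBody M g)) { state := C.state, found := b, tok := b' } m
      { state := ((Cfg.searchStep g κ)^[n] C).state, found := c }
      { m with left := ((Cfg.searchStep g κ)^[n] C).tape.zip κ,
               head := ((Cfg.searchStep g κ)^[n] C).pos, a := 0 }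
      (n * (15 * C.tape.length + 24) + 1) := by
  induction n generalizing C m b b' with
  | zero =>
    refine ⟨b, (eachA_exit ha).cast rfl ?_ (by omega)⟩
    cases m; simp_all
  | succ n ih =>
    obtain ⟨c, c', h1⟩ := exec_searchBody (α := α) g κ C b true { m with a := n } hκ hC hr hb hl hp
    obtain ⟨c'', h2⟩ := ih (C.searchStep g κ) c c' { m with
      a := n, left := (C.searchStep g κ).tape.zip κ, head := (C.searchStep g κ).pos }
      (hκ.trans (C.length_searchStep g κ).symm) hC.searchStep rfl hr hb rfl rfl
    refine ⟨c'', (eachA_step ha h1 h2).cast ?_ ?_ ?_⟩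
    · rw [Function.iterate_succ_apply]
    · simp only [Function.iterate_succ_apply]
    · rw [C.length_searchStep g κ]; nlinarith

/-- As `searchStep` fixes accepted configurations, the loop can run for the full clock without early
exit, and one check at the end decides. -/
theorem exec_search {M : Machine} (g : M.State) (κ : List (Option Bool)) (n : ℕ) (C : Cfg M)
    (m : Mem M.headCount α) (hκ : κ.length = C.tape.length) (hC : C.Bounded) (ha : m.a = n)
    (hr : m.right = []) (hb : m.b = 0) (hl : m.left = C.tape.zip κ) (hp : m.head = C.pos) :
    Exec (search M g) { state := C.state } m
      { state := ((Cfg.searchStep g κ)^[n] C).state,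
        found := ((Cfg.searchStep g κ)^[n] C).accepts g κ }
      { m with left := ((Cfg.searchStep g κ)^[n] C).tape.zip κ,
               head := ((Cfg.searchStep g κ)^[n] C).pos, a := 0 }
      (n * (15 * C.tape.length + 24) + (5 * C.tape.length + 5)) := by
  obtain ⟨c, h1⟩ := exec_searchLoop g κ n C false false m hκ hC ha hr hb hl hp
  refine (h1.seq (exec_check g κ _ _ _ rfl rfl rfl hr)).cast rfl rfl ?_
  rw [(Cfg.iterate_searchStep hC n).2]
  omega

/-! The output. -/

def outLoop : Prg h α S :=
  eachRight (.ite (fun v => v.found && (cellD v).2.isNone)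
    (pushOut fun v => some (cellD v).1) skip)

/-- In use, cells arrive last one first and the output stack reverses them again. Cells without a
requirement are the free ones, which carry the answer. -/
theorem exec_outLoop (l : List Cell) (v : Var α S) (m : Mem h α) (hm : m.right = l) :
    Exec outLoop v m (setCell v none)
      { m with right := [], out := ((l.filter fun c => v.found && c.2.isNone).map
        fun c => some c.1).reverse ++ m.out } (3 * l.length + 1) := by
  induction l generalizing v m with
  | nil => exact (eachRight_exit hm).cast rfl (by cases m; simp_all) (by simp)
  | cons x l ih =>
    by_cases hx : (v.found && x.2.isNone) = true
    · refine (eachRight_step hm (Exec.ite_true hx (exec_pushOut _ _ _)) (ih _ _ rfl)).cast rfl ?_ ?_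
      · simp [hx, cellD, setCell]
      · simp; omega
    · have hx' : (v.found && x.2.isNone) = false := Bool.eq_false_iff.2 hx
      refine (eachRight_step hm (Exec.ite_false hx' (exec_skip _ _)) (ih _ _ rfl)).cast rfl ?_ ?_
      · simp [hx', setCell]
      · simp; omega

def clearHead (i : Fin h) : Prg h α S := eachHead i skip

theorem exec_clearHead (i : Fin h) (n : ℕ) (v : Var α S) (m : Mem h α) (hm : m.head i = n) :
    Exec (clearHead i) v m (setTok v false) { m with head := Function.update m.head i 0 }
      (2 * n + 1) := by
  induction n generalizing v m with
  | zero =>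
    refine (eachHead_exit hm).cast rfl ?_ (by omega)
    rw [← hm, Function.update_eq_self]
  | succ n ih =>
    exact (eachHead_step hm (exec_skip _ _) (ih _ _ (by simp))).cast rfl (by simp) (by omega)

def clearHeads : List (Fin h) → Prg h α S
  | [] => skip
  | i :: l => .seq (clearHead i) (clearHeads l)

theorem exec_clearHeads (B : ℕ) (l : List (Fin h)) (v : Var α S) (m : Mem h α)
    (hm : ∀ i, m.head i ≤ B) :
    ∃ b, Exec (clearHeads l) v m (setTok v b)
      { m with head := fun i => if i ∈ l then 0 else m.head i } (l.length * (2 * B + 1) + 1) := by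
  induction l generalizing v m with
  | nil => exact ⟨v.tok, (exec_skip v m).cast rfl (by simp) (by simp)⟩
  | cons i l ih =>
    obtain ⟨b, hb⟩ := ih (setTok v false) { m with head := Function.update m.head i 0 } (by
      intro j
      by_cases hj : j = i
      · subst hj; simp
      · simpa [hj] using hm j)
    refine ⟨b, ((exec_clearHead i _ v m rfl).seq hb).cast rfl ?_ ?_⟩
    · simp only [Mem.mk.injEq, true_and]
      funext j
      by_cases hj : j = i
      · subst hj; simp
      · simp [hj]
    · have := hm i
      simp only [List.length_cons]
      nlinarith

/-- Write the output and clear all other stacks. -/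
def finish (v₀ : Var α S) : Prg h α S :=
  .seq unwind (.seq outLoop (.seq (.ite (fun v => v.found) skip (pushOut fun _ => none))
    (.seq (clearHeads (List.finRange h)) (.load fun _ => v₀))))

theorem exec_finish (v₀ v : Var α S) (m : Mem h α) (B : ℕ) (hB : ∀ i, m.head i ≤ B)
    (hi : m.inp = []) (ho : m.out = []) (hr : m.right = []) (ha : m.a = 0) (hb : m.b = 0) :
    Exec (finish v₀) v m v₀
      { out := encodeOutput (if v.found then
          some ((m.left.filter fun c => c.2.isNone).map fun c => c.1) else none) }
      (5 * m.left.length + h * (2 * B + 1) + 7) := by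
  have h1 := exec_unwind m.left v m rfl
  have h2 := exec_outLoop m.left.reverse (setCell v none)
    { m with left := [], right := m.left.reverse } rfl
  obtain ⟨b, h4⟩ := exec_clearHeads B (List.finRange h) (setCell v none)
    { m with left := [], right := [], out := encodeOutput (if v.found then
          some ((m.left.filter fun c => c.2.isNone).map fun c => c.1) else none) } hB
  refine ((h1.cast rfl (by simp [hr]) le_rfl).seq (h2.seq (Exec.seq (t := 2) ?_
    (h4.seq (exec_load _ _ _))))).cast rfl ?_ ?_
  · cases hf : v.found with
    | true =>
      refine (Exec.ite_true (by simp [setCell, hf]) (exec_skip _ _)).cast rfl ?_ le_rfl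
      simp [setCell, hf, ho, encodeOutput, Function.comp_def]
    | false =>
      refine (Exec.ite_false (by simp [setCell, hf]) (exec_pushOut _ _ _)).cast rfl ?_ le_rfl
      simp [setCell, hf, ho, encodeOutput]
  · simp [hi, ha, hb]
  · simp; omega

end Prg
end InPlace

/-! ### The complete search program and its polynomial running time -/

namespace InPlace

open Turing

/-- The final requirements on a tape with `n` free cells, `s` zeros, and the cells `τ`. -/
def requirements (n s : ℕ) (τ : List Bool) : List (Option Bool) :=
  List.replicate n none ++ List.replicate s (some false) ++ τ.map some

/-- The tape at the start of the search. -/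
def startTape (y : List Bool) (s : ℕ) (τ : List Bool) : List Bool :=
  y ++ List.replicate s true ++ τ

theorem length_requirements (n s : ℕ) (τ : List Bool) :
    (requirements n s τ).length = n + s + τ.length := by
  simp [requirements, add_assoc]

theorem length_startTape (y : List Bool) (s : ℕ) (τ : List Bool) :
    (startTape y s τ).length = y.length + s + τ.length := by
  simp [startTape, add_assoc]

/-- The configuration in the state `q` with all heads at the left end marker. -/
def Machine.leftCfg (M : Machine) (q : M.State) (tape : List Bool) : Cfg M where
  state := q
  tape := tape
  pos := fun _ => 0

/-- Run `M` from the state `q` until a configuration with state `g` that meets the requirements,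
for a polynomial number of steps, and return the free cells of this configuration. -/
noncomputable def Machine.searchResult (M : Machine) (q g : M.State) (d : ℕ) (tape : List Bool)
    (κ : List (Option Bool)) : Option (List Bool) :=
  let C := (Cfg.searchStep g κ)^[(tape.length + 2) ^ d] (M.leftCfg q tape)
  if C.accepts g κ then some (((C.tape.zip κ).filter fun c => c.2.isNone).map fun c => c.1)
  else none

/-- These are the three kinds of cells that the reading phase pushes: free ones, work space that
starts with one and must end with zero, and catalytic cells that must regain their initial content.
-/
theorem zip_startTape (y : List Bool) (s : ℕ) (τ : List Bool) :
    (startTape y s τ).zip (requirements y.length s τ) =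
      (y.map fun b => (b, none)) ++ List.replicate s (true, some false) ++
        τ.map fun b => (b, some b) := by
  rw [startTape, requirements, List.zip_append (by simp), List.zip_append (by simp)]
  congr 1
  · congr 1
    · induction y with
      | nil => rfl
      | cons b y ih => simpa [List.replicate_succ] using ih
    · simp
  · induction τ with
    | nil => rfl
    | cons b τ ih => simpa using ih

namespace Prg

open StackProg

variable {α : Type}

/-- The program for `Machine.searchResult`. -/
noncomputable def searchProgram (M : Machine) (toSym : α → Option Bool) (k d : ℕ)
    (q g : M.State) : Prg M.headCount α M.State :=
  .seq (parse toSym (fun _ => none) pushA) (.seq popA (.seq (padLog k)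
    (.seq (parse toSym some skip) (.seq rewind (.seq (clock d) (.seq (search M g)
      (finish { state := q })))))))

/-- A time bound for `searchProgram` on an input of length `L` and a tape of length `N`. -/
def timeBound (k d h L N : ℕ) : ℕ :=
  (6 * L + 4) + L * (7 * L + k + 8) + (12 * N + 20) + d * (7 * (N + 2) ^ d + 2) +
    (N + 2) ^ d * (15 * N + 24) + h * (2 * (N + 1) + 1)

theorem timeBound_mono (k d h : ℕ) {L N N' : ℕ} (hN : N ≤ N') :
    timeBound k d h L N ≤ timeBound k d h L N' := by
  unfold timeBound
  gcongr

theorem exec_searchProgram (M : Machine) (toSym : α → Option Bool) (k d : ℕ) (q g : M.State)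
    (u u' r : List α) (y τ : List Bool) (hu : u.map toSym = y.map some)
    (hr : r.head?.any (fun x => (toSym x).isSome) = false) (hr' : r.tail = u')
    (hu' : u'.map toSym = τ.map some) :
    Exec (searchProgram M toSym k d q g) { state := q } { inp := u ++ r } { state := q }
      { out := encodeOutput (M.searchResult q g d (startTape y (k * Nat.clog 2 y.length) τ)
          (requirements y.length (k * Nat.clog 2 y.length) τ)) }
      (timeBound k d M.headCount (u ++ r).length
        (startTape y (k * Nat.clog 2 y.length) τ).length) := by
  set s := k * Nat.clog 2 y.length with hs
  set tape := startTape y s τ with htape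
  set κ := requirements y.length s τ with hκ
  have hlen : κ.length = tape.length := by
    rw [htape, hκ, length_requirements, length_startTape]
  -- `padLog` expects the length minus one, which `popA` provides; for length zero both logarithms
  -- vanish.
  have hclog : Nat.clog 2 (y.length - 1 + 1) = Nat.clog 2 y.length := by
    rcases Nat.eq_zero_or_pos y.length with h0 | h0
    · simp [h0]
    · rw [Nat.sub_add_cancel h0]
  have hb : (M.leftCfg q tape).Bounded := fun _ => Nat.zero_le _
  have h1 := exec_parse (h := M.headCount) toSym (fun _ => none) pushA 1 exec_pushA r hr u y hu
    { state := q } { inp := u ++ r } rfl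
  have h2 := exec_popA (setInb { state := q } r.head?) ({
    inp := u', right := (y.map fun b => (b, none)).reverse, a := y.length } : Mem M.headCount α)
  have h3 := exec_padLog k (y.length - 1)
    (setTok (setInb { state := q } r.head?) (decide (y.length ≠ 0))) ({
      inp := u', right := (y.map fun b => (b, none)).reverse, a := y.length - 1 } :
        Mem M.headCount α) rfl rfl rfl
  have h4 := exec_parse (h := M.headCount) toSym some skip 0 exec_skip [] rfl u' τ hu'
    (setInb { state := q } r.head?)
    { inp := u', right := List.replicate s (true, some false) ++
        (y.map fun b => (b, none)).reverse } (List.append_nil u').symm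
  have h5 := exec_rewind (tape.zip κ).reverse { state := q }
    ({ right := (tape.zip κ).reverse } : Mem M.headCount α) rfl
  have h6 := exec_clock d { state := q }
    ({ left := tape.zip κ } : Mem M.headCount α) rfl rfl rfl rfl rfl
  have hz : (tape.zip κ).length = tape.length := by simp [hlen]
  dsimp only at h6
  rw [hz] at h6
  have h7 := exec_search (α := α) g κ ((tape.length + 2) ^ d) (M.leftCfg q tape)
    { left := tape.zip κ, a := (tape.length + 2) ^ d } hlen hb rfl rfl rfl rfl rfl
  obtain ⟨hit, hit'⟩ := Cfg.iterate_searchStep (g := g) (κ := κ) hb ((tape.length + 2) ^ d)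
  set C := (Cfg.searchStep g κ)^[(tape.length + 2) ^ d] (M.leftCfg q tape) with hC
  rw [Cfg.Bounded, hit'] at hit
  have h8 := exec_finish { state := q } { state := C.state, found := C.accepts g κ }
    ({ left := C.tape.zip κ, head := C.pos } : Mem M.headCount α) (tape.length + 1) hit
    rfl rfl rfl rfl rfl
  have hy : y.length ≤ (u ++ r).length := by
    have := congrArg List.length hu
    simp only [List.length_map] at this
    simp [this]
  have hτ : τ.length ≤ (u ++ r).length := by
    have := congrArg List.length hu'
    simp only [List.length_map, ← hr', List.length_tail] at this
    simp only [List.length_append]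
    omega
  rw [hclog] at h3
  refine ((h1.cast rfl ?_ le_rfl).seq (h2.seq ((h3.cast rfl rfl le_rfl).seq
    ((h4.cast rfl ?_ le_rfl).seq ((h5.cast rfl ?_ le_rfl).seq (h6.seq (h7.seq h8))))))).cast
      rfl rfl ?_
  · simp [hr']
  · simp [htape, hκ, zip_startTape]
  · simp
  · have hzC : (C.tape.zip κ).length ≤ tape.length := by
      rw [← show C.tape.length = tape.length from hit']; simp
    have hL : (y.length - 1) * (7 * (y.length - 1) + k + 8) ≤
        (u ++ r).length * (7 * (u ++ r).length + k + 8) := by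
      have : y.length - 1 ≤ (u ++ r).length := by omega
      gcongr
    have hl : (M.leftCfg q tape).tape.length = tape.length := rfl
    rw [hl, timeBound]
    simp only [List.length_reverse, hz]
    omega

/-- The stack machine for `Machine.searchResult`. -/
theorem nonempty_computable (M : Machine) [Fintype α] (toSym : α → Option Bool) (k d : ℕ)
    (q g : M.State) {β : Type} (enc : β → List α) (y τ : β → List Bool)
    (henc : ∀ z, ∃ u u' r, enc z = u ++ r ∧ u.map toSym = (y z).map some ∧
      r.head?.any (fun x => (toSym x).isSome) = false ∧ r.tail = u' ∧
      u'.map toSym = (τ z).map some) (A : β → Option (List Bool))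
    (hA : ∀ z, A z = M.searchResult q g d (startTape (y z) (k * Nat.clog 2 (y z).length) (τ z))
      (requirements (y z).length (k * Nat.clog 2 (y z).length) (τ z))) :
    Nonempty (TM2ComputableInPolyTime enc encodeOutput A) := by
  have := M.stateFintype
  have : Fintype (Stk M.headCount) := Fintype.ofFinite _
  have : Fintype (Var α M.State) := Fintype.ofFinite _
  have key : ∀ z, Nonempty (TM2OutputsInTime
      (toFinTM2 (searchProgram M toSym k d q g) .inp .out { state := q }) (enc z)
      (some (encodeOutput (A z)))
      (timeBound k d M.headCount (enc z).length ((k + 2) * (enc z).length) + 1)) := by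
    intro z
    obtain ⟨u, u', r, he, hu, hr, hr', hu'⟩ := henc z
    have h := exec_searchProgram M toSym k d q g u u' r (y z) (τ z) hu hr hr' hu'
    rw [← hA, ← he] at h
    -- The tape is linear in the input because `⌈log₂ n⌉ ≤ n`.
    have hN : (startTape (y z) (k * Nat.clog 2 (y z).length) (τ z)).length ≤
        (k + 2) * (enc z).length := by
      have h1 : (y z).length ≤ (enc z).length := by
        have := congrArg List.length hu
        simp only [List.length_map] at this
        simp [he, this]
      have h2 : (τ z).length ≤ (enc z).length := by
        have := congrArg List.length hu'
        simp only [List.length_map, ← hr', List.length_tail] at this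
        simp only [he, List.length_append]
        omega
      have h3 : Nat.clog 2 (y z).length ≤ (enc z).length :=
        (Nat.clog_le_of_le_pow Nat.lt_two_pow_self.le).trans h1
      rw [length_startTape]
      nlinarith
    have h' := h.mono (timeBound_mono k d M.headCount hN)
    refine Runs.outputsInTime ?_
    have h0 : (fun _ => []) = ({} : Mem M.headCount α).stk := by
      funext s; cases s <;> rfl
    have hi := Mem.update_inp ({} : Mem M.headCount α) (enc z)
    have ho := Mem.update_out ({} : Mem M.headCount α) (encodeOutput (A z))
    rw [← h0] at hi ho
    exact hi.symm ▸ ho.symm ▸ h'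
  -- The bound for the tape length as a polynomial, to be inserted into `timeBound`.
  let NN : Polynomial ℕ := Polynomial.C (k + 2) * Polynomial.X
  exact ⟨{
    tm := toFinTM2 (searchProgram M toSym k d q g) .inp .out { state := q }
    inputAlphabet := Equiv.refl _
    outputAlphabet := Equiv.refl _
    time := (6 * .X + 4) + .X * (7 * .X + .C (k + 8)) + (12 * NN + 20) +
      .C d * (7 * (NN + 2) ^ d + 2) + (NN + 2) ^ d * (15 * NN + 24) +
      .C M.headCount * (2 * (NN + 1) + 1) + 1
    -- The alphabets are identified by identity equivalences; the cast absorbs the resulting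
    -- `List.map` and evaluates the time polynomial.
    outputsFun := fun z => by
      have hmap : ∀ {γ : Type} (l : List γ), l = l.map (Equiv.refl γ).invFun :=
        fun l => (List.map_id l).symm
      refine cast ?_ (Classical.choice (key z))
      refine (congrArg₂ (fun a b => TM2OutputsInTime _ a (some b) _) (hmap _) (hmap _)).trans ?_
      refine congrArg (TM2OutputsInTime _ _ _) ?_
      simp [timeBound, NN, add_assoc] }⟩

end Prg
end InPlace

/-! ### Normalized machines: heads start and end at the left marker -/

namespace InPlace

open StateTransition Relation

/-- The states of the normalized machine. -/
inductive NormState (Q : Type) (h : ℕ) where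
  | pre (i : Fin h)
  | run (q : Q)
  | post (i : Fin h)
  | final

instance (Q : Type) (h : ℕ) [Finite Q] : Finite (NormState Q h) :=
  Finite.of_injective (β := (Fin h ⊕ Fin h) ⊕ Option Q)
    (fun | .pre i => .inl (.inl i) | .post i => .inl (.inr i) | .run q => .inr (some q)
         | .final => .inr none)
    (by rintro (_ | _ | _ | _) (_ | _ | _ | _) <;> simp)

theorem scan_eq_leftEnd {tape : List Bool} {p : ℕ} : scan tape p = .leftEnd ↔ p = 0 := by
  cases p with
  | zero => simp [scan]
  | succ p =>
    rcases lt_or_ge p tape.length with hp | hp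
    · simp [scan_succ_of_lt hp]
    · simp [scan_succ_of_le hp]

theorem scan_eq_rightEnd {tape : List Bool} {p : ℕ} :
    scan tape p = .rightEnd ↔ tape.length < p := by
  cases p with
  | zero => simp [scan]
  | succ p =>
    rcases lt_or_ge p tape.length with hp | hp
    · simp [scan_succ_of_lt hp]; omega
    · simp [scan_succ_of_le hp]; omega

namespace Machine

variable (M : Machine)

theorem step_eq_some {C : Cfg M} {a : M.State × Bool × Move}
    (h : M.trans C.state (scan C.tape (C.pos (M.active C.state))) = some a) :
    M.step C = some
      { state := a.1
        tape := write C.tape a.2.1 (C.pos (M.active C.state))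
        pos := Function.update C.pos (M.active C.state)
          (a.2.2.apply C.tape.length (C.pos (M.active C.state))) } := by
  simp [step, h]

theorem headCount_pos : 0 < M.headCount := (M.active M.start).pos

/-- The state after the first heads up to `i` were moved to the tape. -/
def afterPre (i : Fin M.headCount) : NormState M.State M.headCount :=
  if hi : i.val + 1 < M.headCount then .pre ⟨i + 1, hi⟩ else .run M.start

/-- The state after the first heads up to `i` were moved to the left end marker. -/
def afterPost (i : Fin M.headCount) : NormState M.State M.headCount :=
  if hi : i.val + 1 < M.headCount then .post ⟨i + 1, hi⟩ else .final

/-- The machine `M`, modified such that all heads start and end at the left end marker. -/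
noncomputable def normalize : Machine where
  State := NormState M.State M.headCount
  stateFintype := have := M.stateFintype; Fintype.ofFinite _
  headCount := M.headCount
  start := .pre ⟨0, M.headCount_pos⟩
  active
    | .pre i => i
    | .run q => M.active q
    | .post i => i
    | .final => ⟨0, M.headCount_pos⟩
  trans
    | .pre i, .leftEnd => some (M.afterPre i, false, .right)
    | .pre _, _ => none
    | .run q, s => match M.trans q s with
      | some a => some (.run a.1, a.2)
      | none => some (.post ⟨0, M.headCount_pos⟩, s.toBit, .stay)
    | .post i, .leftEnd => some (M.afterPost i, false, .stay)
    | .post i, s => some (.post i, s.toBit, .left)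
    | .final, _ => none

/-- A configuration of the normalized machine. -/
def normCfg (q : NormState M.State M.headCount) (tape : List Bool) (pos : Fin M.headCount → ℕ) :
    Cfg M.normalize where
  state := q
  tape := tape
  pos := pos

/-- Halting in a nonfinal state when the head is off the left marker is what later forces the head
positions of a start configuration. -/
theorem step_pre (i : Fin M.headCount) (tape : List Bool) (pos : Fin M.headCount → ℕ) :
    M.normalize.step (M.normCfg (.pre i) tape pos) =
      if pos i = 0 then some (M.normCfg (M.afterPre i) tape (Function.update pos i 1))
      else none := by
  by_cases hp : pos i = 0
  · have hs : scan tape (pos i) = .leftEnd := scan_eq_leftEnd.2 hp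
    rw [if_pos hp, step_eq_some (a := (M.afterPre i, false, .right))]
    · simp [normCfg, normalize, hp, write, Move.apply]
      rfl
    · simp [normCfg, normalize, hs]
  · rw [if_neg hp]
    have hs : scan tape (pos i) ≠ .leftEnd := fun h => hp (scan_eq_leftEnd.1 h)
    cases hs' : scan tape (pos i) with
    | leftEnd => exact absurd hs' hs
    | _ => simp [step, normCfg, normalize, hs']

theorem step_post (i : Fin M.headCount) (tape : List Bool) (pos : Fin M.headCount → ℕ) :
    M.normalize.step (M.normCfg (.post i) tape pos) =
      some (if pos i = 0 then M.normCfg (M.afterPost i) tape pos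
        else M.normCfg (.post i) tape (Function.update pos i (pos i - 1))) := by
  by_cases hp : pos i = 0
  · have hs : scan tape (pos i) = .leftEnd := scan_eq_leftEnd.2 hp
    rw [if_pos hp, step_eq_some (a := (M.afterPost i, false, .stay))]
    · simp only [normCfg, normalize, hp, write, Move.apply, Option.some_inj, Cfg.mk.injEq, true_and]
      exact (congrArg (Function.update pos i) hp.symm).trans (Function.update_eq_self i pos)
    · simp [normCfg, normalize, hs]
  · rw [if_neg hp]
    have hs : scan tape (pos i) ≠ .leftEnd := fun h => hp (scan_eq_leftEnd.1 h)
    rw [step_eq_some (a := (NormState.post i, (scan tape (pos i)).toBit, .left))]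
    · simp [normCfg, normalize, Move.apply, write_scan_toBit]
      rfl
    · cases hs' : scan tape (pos i) with
      | leftEnd => exact absurd hs' hs
      | _ => simp [normCfg, normalize, hs']

theorem reaches_pre (tape : List Bool) (n : ℕ) (i : Fin M.headCount)
    (hn : i.val + n + 1 = M.headCount) (pos : Fin M.headCount → ℕ)
    (hpos : ∀ j, pos j = if j < i then 1 else 0) :
    Reaches M.normalize.step (M.normCfg (.pre i) tape pos)
      (M.normCfg (.run M.start) tape fun _ => 1) := by
  induction n generalizing i pos with
  | zero =>
    refine ReflTransGen.single ?_
    rw [step_pre, if_pos (by simp [hpos]), afterPre, dif_neg (by omega)]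
    refine congrArg (fun p => some (M.normCfg _ _ p)) (funext fun j => ?_)
    by_cases hj : j = i
    · subst hj; simp
    · have : j < i := by omega
      simp [hj, hpos, this]
  | succ n ih =>
    have hi : i.val + 1 < M.headCount := by omega
    refine ReflTransGen.head ?_ (ih ⟨i + 1, hi⟩ (by simp; omega) (Function.update pos i 1) ?_)
    · rw [step_pre, if_pos (by simp [hpos]), afterPre, dif_pos hi]; rfl
    · intro j
      by_cases hj : j = i
      · subst hj; simp [Fin.lt_def]
      · rw [Function.update_of_ne hj, hpos]
        simp only [Fin.lt_def]
        have : j.val ≠ i.val := fun h => hj (Fin.ext h)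
        split_ifs <;> omega

theorem reaches_post_self (tape : List Bool) (i : Fin M.headCount) (n : ℕ)
    (pos : Fin M.headCount → ℕ) (hn : pos i = n) :
    Reaches M.normalize.step (M.normCfg (.post i) tape pos)
      (M.normCfg (M.afterPost i) tape (Function.update pos i 0)) := by
  induction n generalizing pos with
  | zero =>
    refine ReflTransGen.single ?_
    rw [step_post, if_pos hn, ← hn, Function.update_eq_self]; rfl
  | succ n ih =>
    have h1 := ih (Function.update pos i n) (by simp)
    rw [Function.update_idem] at h1
    refine ReflTransGen.head ?_ h1
    rw [step_post, if_neg (by omega), hn]; rfl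

theorem reaches_post (tape : List Bool) (n : ℕ) (i : Fin M.headCount)
    (hn : i.val + n + 1 = M.headCount) (pos : Fin M.headCount → ℕ)
    (hpos : ∀ j, j < i → pos j = 0) :
    Reaches M.normalize.step (M.normCfg (.post i) tape pos)
      (M.normCfg .final tape fun _ => 0) := by
  induction n generalizing i pos with
  | zero =>
    have h1 := M.reaches_post_self tape i _ pos rfl
    rw [afterPost, dif_neg (by omega)] at h1
    convert h1 using 2
    funext j
    by_cases hj : j = i
    · subst hj; simp
    · rw [Function.update_of_ne hj, hpos j (by omega)]
  | succ n ih =>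
    have hi : i.val + 1 < M.headCount := by omega
    have h1 := M.reaches_post_self tape i _ pos rfl
    rw [afterPost, dif_pos hi] at h1
    refine h1.trans (ih ⟨i + 1, hi⟩ (by simp; omega) _ ?_)
    intro j hj
    by_cases hj' : j = i
    · subst hj'; simp
    · rw [Function.update_of_ne hj']
      simp only [Fin.lt_def] at hj
      have : j.val ≠ i.val := fun h => hj' (Fin.ext h)
      exact hpos j (by omega)

theorem step_run {C C' : Cfg M} (h : M.step C = some C') :
    M.normalize.step (M.normCfg (.run C.state) C.tape C.pos) =
      some (M.normCfg (.run C'.state) C'.tape C'.pos) := by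
  cases ht : M.trans C.state (scan C.tape (C.pos (M.active C.state))) with
  | none => simp [step, ht] at h
  | some a =>
    rw [step_eq_some _ ht] at h
    rw [step_eq_some (a := (NormState.run a.1, a.2))]
    · cases h; rfl
    · simp [normCfg, normalize, ht]

theorem step_run_halt {C : Cfg M} (h : M.step C = none) :
    M.normalize.step (M.normCfg (.run C.state) C.tape C.pos) =
      some (M.normCfg (.post ⟨0, M.headCount_pos⟩) C.tape C.pos) := by
  cases ht : M.trans C.state (scan C.tape (C.pos (M.active C.state))) with
  | some a => simp [step, ht] at h
  | none =>
    rw [step_eq_some (a := (NormState.post ⟨0, M.headCount_pos⟩,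
      (scan C.tape (C.pos (M.active C.state))).toBit, .stay))]
    · simp [normCfg, normalize, write_scan_toBit, Move.apply]
      exact Function.update_eq_self _ C.pos
    · simp [normCfg, normalize, ht]

theorem step_final (tape : List Bool) (pos : Fin M.headCount → ℕ) :
    M.normalize.step (M.normCfg .final tape pos) = none := by
  simp [step, normalize, normCfg]

/-- If `M` takes `t` to `t'` then so does the normalized machine. -/
theorem HaltsWith.normalize {M : Machine} {t t' : List Bool} (h : M.HaltsWith t t') :
    Reaches M.normalize.step (M.normalize.leftCfg M.normalize.start t)
      (M.normalize.leftCfg NormState.final t') := by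
  obtain ⟨C, hC, hC', rfl⟩ := h
  have h1 : Reaches M.normalize.step (M.normalize.leftCfg M.normalize.start t)
      (M.normCfg (.run M.start) t fun _ => 1) :=
    M.reaches_pre t (M.headCount - 1) ⟨0, M.headCount_pos⟩
      (by have := M.headCount_pos; simp; omega) _ (fun j => by simp [Fin.lt_def])
  have h2 : Reaches M.normalize.step (M.normCfg (.run M.start) t fun _ => 1)
      (M.normCfg (.run C.state) C.tape C.pos) :=
    ReflTransGen.lift (fun C : Cfg M => M.normCfg (.run C.state) C.tape C.pos)
      (p := fun a b => b ∈ M.normalize.step a) (fun a b (h : b ∈ M.step a) => M.step_run h) _ _ hC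
  have h3 : Reaches M.normalize.step (M.normCfg (.post ⟨0, M.headCount_pos⟩) C.tape C.pos)
      (M.normCfg .final C.tape fun _ => 0) :=
    M.reaches_post C.tape (M.headCount - 1) ⟨0, M.headCount_pos⟩
      (by have := M.headCount_pos; simp; omega) _ (fun j hj => by simp [Fin.lt_def] at hj)
  exact (h1.trans h2).trans (h3.head (M.step_run_halt hC'))

/-- Each preamble state lets the run continue only if its head is at the left marker, and no head
moves before its own test. So reaching `final` certifies the original positions of the heads still
to be tested. -/
theorem pos_eq_zero_of_reaches_pre {t t' : List Bool} {pos' : Fin M.headCount → ℕ} (n : ℕ)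
    (i : Fin M.headCount) (hn : i.val + n + 1 = M.headCount) (pos : Fin M.headCount → ℕ)
    (h : Reaches M.normalize.step (M.normCfg (.pre i) t pos) (M.normCfg .final t' pos'))
    (j : Fin M.headCount) (hj : i ≤ j) : pos j = 0 := by
  induction n generalizing i pos with
  | zero =>
    rcases ReflTransGen.cases_head h with h | ⟨C, hC, -⟩
    · exact absurd (congrArg Cfg.state h) (by simp [normCfg])
    · rw [Option.mem_def, step_pre] at hC
      have : j = i := by omega
      subst this
      by_contra hp
      simp [hp] at hC
  | succ n ih =>
    rcases ReflTransGen.cases_head h with h | ⟨C, hC, h'⟩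
    · exact absurd (congrArg Cfg.state h) (by simp [normCfg])
    · rw [Option.mem_def, step_pre] at hC
      have hp : pos i = 0 := by
        by_contra hp
        simp [hp] at hC
      rcases eq_or_ne j i with rfl | hji
      · exact hp
      · have hi : i.val + 1 < M.headCount := by omega
        rw [if_pos hp, Option.some_inj, afterPre, dif_pos hi] at hC
        subst hC
        have hlt : i.val ≠ j.val := fun h => hji (Fin.ext h.symm)
        have := ih ⟨i + 1, hi⟩ (by simp; omega) _ h' (by
          simp only [Fin.le_def] at hj ⊢
          omega)
        rwa [Function.update_of_ne hji] at this

/-- A configuration in the start state from which the final state is reached has all heads at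
the left end marker. -/
theorem eq_leftCfg_of_reaches {C : Cfg M.normalize} {t' : List Bool}
    (hs : C.state = M.normalize.start)
    (h : Reaches M.normalize.step C (M.normalize.leftCfg NormState.final t')) :
    C = M.normalize.leftCfg M.normalize.start C.tape := by
  obtain ⟨q, t, pos⟩ := C
  dsimp only at hs
  subst hs
  refine congrArg (Cfg.mk _ _) (funext fun j => ?_)
  exact M.pos_eq_zero_of_reaches_pre (M.headCount - 1) ⟨0, M.headCount_pos⟩
    (by have := M.headCount_pos; simp; omega) pos h j (Fin.le_def.2 (Nat.zero_le _))

end Machine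
end InPlace

/-! ### Undoing a single step, and the tour -/

namespace InPlace

open StateTransition Relation

/-- The scanned symbol after writing. -/
def Scan.after : Scan → Bool → Scan
  | bit _, b => bit b
  | s, _ => s

namespace Move

/-- The opposite move. -/
def rev : Move → Move
  | left => right
  | stay => stay
  | right => left

/-- The move that undoes the effect of a move made when scanning a given symbol. -/
def back : Move → Scan → Move
  | left, .leftEnd => stay
  | left, _ => right
  | stay, _ => stay
  | right, .rightEnd => stay
  | right, _ => left

/-- The move is not stopped by an end marker. -/
def Free : Move → Scan → Prop
  | left, .leftEnd => False
  | right, .rightEnd => False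
  | _, _ => True

theorem free_iff {mv : Move} {tape : List Bool} {p : ℕ} :
    mv.Free (scan tape p) ↔ (mv = left → p ≠ 0) ∧ (mv = right → p ≤ tape.length) := by
  rcases hs : scan tape p with _ | b | _
  · cases mv <;> simp [Free, scan_eq_leftEnd.1 hs]
  · have h1 : p ≠ 0 := fun h => by simp [scan_eq_leftEnd.2 h] at hs
    have h2 : p ≤ tape.length := by
      by_contra h
      simp [scan_eq_rightEnd.2 (not_le.1 h)] at hs
    cases mv <;> simp [Free, h1, h2]
  · have := scan_eq_rightEnd.1 hs
    cases mv <;> simp [Free] <;> omega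

theorem stay_apply (N p : ℕ) : stay.apply N p = p := rfl

theorem apply_rev_apply {mv : Move} {tape : List Bool} {p : ℕ} (hp : p ≤ tape.length + 1)
    (h : mv.Free (scan tape p)) :
    mv.rev.apply tape.length (mv.apply tape.length p) = p := by
  obtain ⟨h1, h2⟩ := free_iff.1 h
  cases mv <;> simp [rev, apply] at * <;> omega

theorem back_left (tape : List Bool) (p : ℕ) :
    left.back (scan tape p) = if p = 0 then stay else right := by
  split_ifs with h
  · rw [scan_eq_leftEnd.2 h]; rfl
  · have : scan tape p ≠ .leftEnd := fun h' => h (scan_eq_leftEnd.1 h')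
    cases hs : scan tape p <;> simp_all [back]

theorem back_right (tape : List Bool) (p : ℕ) :
    right.back (scan tape p) = if tape.length < p then stay else left := by
  split_ifs with h
  · rw [scan_eq_rightEnd.2 h]; rfl
  · have : scan tape p ≠ .rightEnd := fun h' => h (scan_eq_rightEnd.1 h')
    cases hs : scan tape p <;> simp_all [back]

theorem back_stay (s : Scan) : stay.back s = stay := by
  cases s <;> rfl

/-- A move blocked by a marker acts like `stay`, and `back` records it as such; hence the actual
displacement is the opposite of `back`. -/
theorem apply_eq_rev_back (mv : Move) {tape : List Bool} {p : ℕ} (hp : p ≤ tape.length + 1) :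
    mv.apply tape.length p = (mv.back (scan tape p)).rev.apply tape.length p := by
  cases mv
  · rw [back_left]; split_ifs with h <;> simp [rev, apply, h]
  · rw [back_stay]; rfl
  · rw [back_right]; split_ifs with h <;> simp [rev, apply]; omega

/-- The undoing move either stays or returns to the position just left, so no marker stops it. The
tapes may differ because a symbol is written in between. -/
theorem free_back (mv : Move) {tape tape' : List Bool} {p : ℕ} (hp : p ≤ tape.length + 1)
    (hl : tape'.length = tape.length) :
    (mv.back (scan tape p)).Free (scan tape' (mv.apply tape.length p)) := by
  rw [free_iff, hl]
  cases mv
  · rw [back_left]; split_ifs with h <;> simp [apply]; omega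
  · rw [back_stay]; simp
  · rw [back_right]; split_ifs with h <;> simp [apply]

theorem back_apply (mv : Move) {tape : List Bool} {p : ℕ} (hp : p ≤ tape.length + 1) :
    (mv.back (scan tape p)).apply tape.length (mv.apply tape.length p) = p := by
  cases mv
  · rw [back_left]; split_ifs with h <;> simp [apply] <;> omega
  · rw [back_stay]; rfl
  · rw [back_right]; split_ifs with h <;> simp [apply] <;> omega

end Move

theorem scan_write (tape : List Bool) (b : Bool) (p : ℕ) :
    scan (write tape b p) p = (scan tape p).after b := by
  cases p with
  | zero => rfl
  | succ p =>
    rcases lt_or_ge p tape.length with hp | hp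
    · rw [scan_succ_of_lt hp, scan_succ_of_lt (by simpa [write] using hp)]
      simp [write, Scan.after]
    · rw [scan_succ_of_le hp, scan_succ_of_le (by simpa [write] using hp)]
      rfl

theorem write_write (tape : List Bool) (b b' : Bool) (p : ℕ) :
    write (write tape b p) b' p = write tape b' p := by
  cases p <;> simp [write]

/-- If a position looks as if `b` had been written over `s`, then `s` can be put back; for a marker
`s` nothing is written and the marker is already there. -/
theorem scan_write_of_eq_after {tape : List Bool} {p : ℕ} {s : Scan} {b : Bool}
    (h : scan tape p = s.after b) : scan (write tape s.toBit p) p = s := by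
  rw [scan_write, h]
  cases s <;> rfl

theorem write_of_eq_after {tape : List Bool} {p : ℕ} {s : Scan} {b : Bool}
    (h : scan tape p = s.after b) : write (write tape s.toBit p) b p = tape := by
  rw [write_write]
  cases p with
  | zero => rfl
  | succ p =>
    rcases lt_or_ge p tape.length with hp | hp
    · rw [scan_succ_of_lt hp] at h
      cases s with
      | bit c =>
        simp only [Scan.after, Scan.bit.injEq] at h
        rw [← h]; simp [write]
      | _ => simp [Scan.after] at h
    · exact List.set_eq_of_length_le hp

/-! ### The depth-first search of the backward computations -/

/-- The states of the tour: `explore q e` for trying the predecessors from the number `e` on,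
`check q e` for testing whether the predecessor number `e` exists. -/
inductive TourState (Q : Type) (B : ℕ) where
  | explore (q : Q) (e : Fin (B + 1))
  | check (q : Q) (e : Fin B)

instance (Q : Type) (B : ℕ) [Finite Q] : Finite (TourState Q B) :=
  Finite.of_injective (β := (Q × Fin (B + 1)) ⊕ (Q × Fin B))
    (fun | .explore q e => .inl (q, e) | .check q e => .inr (q, e))
    (by rintro (_ | _) (_ | _) <;> simp)

namespace Machine

variable (M : Machine)

instance : Finite M.State := have := M.stateFintype; inferInstance

/-- The number of pairs of a state and a scanned symbol. -/
noncomputable def edgeCount : ℕ := Nat.card (M.State × Scan)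

noncomputable def edgeEquiv : M.State × Scan ≃ Fin M.edgeCount := Finite.equivFin _

/-- The pair of a state and a scanned symbol with a given number. -/
noncomputable def edge (e : Fin M.edgeCount) : M.State × Scan := M.edgeEquiv.symm e

/-- The number of the pair of the state and the scanned symbol. -/
noncomputable def label (q : M.State) (s : Scan) : Fin M.edgeCount := M.edgeEquiv (q, s)

/-- The active head of the tour. -/
noncomputable def tourActive : TourState M.State M.edgeCount → Fin M.headCount
  | .explore q e => if he : e.val < M.edgeCount then M.active (M.edge ⟨e, he⟩).1 else M.active q
  | .check _ e => M.active (M.edge e).1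

open scoped Classical in
/-- The transitions of the tour. -/
noncomputable def tourTrans : TourState M.State M.edgeCount → Scan →
    Option (TourState M.State M.edgeCount × Bool × Move)
  | .explore q e, s =>
    if he : e.val < M.edgeCount then
      match M.trans (M.edge ⟨e, he⟩).1 (M.edge ⟨e, he⟩).2 with
      | none => some (.explore q (Fin.succ ⟨e, he⟩), s.toBit, .stay)
      | some a =>
        if a.1 = q ∧ (a.2.2.back (M.edge ⟨e, he⟩).2).Free s then
          some (.check q ⟨e, he⟩, s.toBit, a.2.2.back (M.edge ⟨e, he⟩).2)
        else some (.explore q (Fin.succ ⟨e, he⟩), s.toBit, .stay)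
    else (M.trans q s).map fun a => (.explore a.1 (M.label q s).succ, a.2)
  | .check q e, s =>
    (M.trans (M.edge e).1 (M.edge e).2).map fun a =>
      if a.1 = q ∧ s = (M.edge e).2.after a.2.1 then
        (.explore (M.edge e).1 0, (M.edge e).2.toBit, .stay)
      else (.explore q e.succ, s.toBit, (a.2.2.back (M.edge e).2).rev)

/-- The Euler tour of the trees of backward computations of `M`. -/
noncomputable def tour : Machine where
  State := TourState M.State M.edgeCount
  stateFintype := Fintype.ofFinite _
  headCount := M.headCount
  start := .explore M.start 0
  active := M.tourActive
  trans := M.tourTrans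

/-- A configuration of the tour. -/
def tourCfg (q : TourState M.State M.edgeCount) (tape : List Bool) (pos : Fin M.headCount → ℕ) :
    Cfg M.tour where
  state := q
  tape := tape
  pos := pos

variable {M} in
theorem step_tourCfg {q : TourState M.State M.edgeCount} {tape : List Bool}
    {pos : Fin M.headCount → ℕ} {i : Fin M.headCount} (hi : M.tourActive q = i)
    {a : TourState M.State M.edgeCount × Bool × Move}
    (ha : M.tourTrans q (scan tape (pos i)) = some a) :
    M.tour.step (M.tourCfg q tape pos) = some (M.tourCfg a.1 (write tape a.2.1 (pos i))
      (Function.update pos i (a.2.2.apply tape.length (pos i)))) := by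
  subst hi
  exact step_eq_some (M := M.tour) ha

end Machine

namespace Cfg

variable {M : Machine}

/-- The tour at the configuration `C`, trying the predecessors from number `e` on. -/
def explore (C : Cfg M) (e : Fin (M.edgeCount + 1)) : Cfg M.tour :=
  M.tourCfg (.explore C.state e) C.tape C.pos

/-- The tour at the configuration `C`, testing the predecessor with number `e`, where the active
head was moved by `mv`. -/
noncomputable def check (C : Cfg M) (e : Fin M.edgeCount) (mv : Move) : Cfg M.tour :=
  M.tourCfg (.check C.state e) C.tape (Function.update C.pos (M.active (M.edge e).1)
    (mv.apply C.tape.length (C.pos (M.active (M.edge e).1))))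

/-- The number of a configuration among the predecessors of its successor. -/
noncomputable def label (C : Cfg M) : Fin M.edgeCount :=
  M.label C.state (scan C.tape (C.pos (M.active C.state)))

/-- Testing the predecessor with number `e` is possible and starts with the move `mv`. -/
def Tests (C : Cfg M) (e : Fin M.edgeCount) (mv : Move) : Prop :=
  ∃ a, M.trans (M.edge e).1 (M.edge e).2 = some a ∧ a.1 = C.state ∧ mv = a.2.2.back (M.edge e).2 ∧
    mv.Free (scan C.tape (C.pos (M.active (M.edge e).1)))

end Cfg

namespace Machine

variable {M : Machine}

theorem edge_label (C : Cfg M) :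
    M.edge C.label = (C.state, scan C.tape (C.pos (M.active C.state))) :=
  M.edgeEquiv.symm_apply_apply _

theorem label_eq_of_edge {C : Cfg M} {e : Fin M.edgeCount}
    (h : M.edge e = (C.state, scan C.tape (C.pos (M.active C.state)))) : C.label = e := by
  rw [Cfg.label, Machine.label, ← h]
  exact M.edgeEquiv.apply_symm_apply _

theorem tourActive_last (q : M.State) :
    M.tourActive (.explore q (Fin.last _)) = M.active q := by
  simp [tourActive]

theorem tourActive_castSucc (q : M.State) (e : Fin M.edgeCount) :
    M.tourActive (.explore q e.castSucc) = M.active (M.edge e).1 := by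
  simp [tourActive]

/-- Once all predecessors are tried, the tour climbs to the parent by a forward step. The label of
the child tells where to resume, which replaces a stack. -/
theorem tour_step_last {C C' : Cfg M} (h : M.step C = some C') :
    M.tour.step (C.explore (Fin.last _)) = some (C'.explore C.label.succ) := by
  cases ht : M.trans C.state (scan C.tape (C.pos (M.active C.state))) with
  | none => simp [step, ht] at h
  | some a =>
    rw [step_eq_some _ ht] at h
    cases h
    exact step_tourCfg (tourActive_last _) (a := (.explore a.1 C.label.succ, a.2))
      (by simp [tourTrans, ht, Cfg.label])

theorem tour_step_last_none {C : Cfg M} (h : M.step C = none) :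
    M.tour.step (C.explore (Fin.last _)) = none := by
  cases ht : M.trans C.state (scan C.tape (C.pos (M.active C.state))) with
  | some a => simp [step, ht] at h
  | none => simp [step, tour, Cfg.explore, tourCfg, tourTrans, tourActive, ht]

theorem tour_step_explore_of_tests {C : Cfg M} {e : Fin M.edgeCount} {mv : Move}
    (h : C.Tests e mv) : M.tour.step (C.explore e.castSucc) = some (C.check e mv) := by
  obtain ⟨a, ha, hq, rfl, hf⟩ := h
  rw [Cfg.explore, step_tourCfg (tourActive_castSucc _ _) (a := (.check C.state e,
    (scan C.tape (C.pos (M.active (M.edge e).1))).toBit, a.2.2.back (M.edge e).2))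
    (by simp [tourTrans, ha, hq, hf]), write_scan_toBit]
  rfl

theorem tour_step_explore_of_not_tests {C : Cfg M} {e : Fin M.edgeCount}
    (h : ∀ mv, ¬ C.Tests e mv) :
    M.tour.step (C.explore e.castSucc) = some (C.explore e.succ) := by
  rw [Cfg.explore, step_tourCfg (tourActive_castSucc _ _) (a := (.explore C.state e.succ,
    (scan C.tape (C.pos (M.active (M.edge e).1))).toBit, .stay)) ?_, write_scan_toBit]
  · simp [Cfg.explore, Move.apply]
  · cases ha : M.trans (M.edge e).1 (M.edge e).2 with
    | none => simp [tourTrans, ha]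
    | some a =>
      have hn : ¬ (a.1 = C.state ∧ (a.2.2.back (M.edge e).2).Free
          (scan C.tape (C.pos (M.active (M.edge e).1)))) :=
        fun hh => h _ ⟨a, ha, hh.1, rfl, hh.2⟩
      simp [tourTrans, ha, hn]

/-- After testing the predecessor with number `e`, the tour passes to the next number, or to this
predecessor. -/
theorem tour_step_check {C : Cfg M} (hC : C.Bounded) {e : Fin M.edgeCount} {mv : Move}
    (h : C.Tests e mv) :
    M.tour.step (C.check e mv) = some (C.explore e.succ) ∨
      ∃ D : Cfg M, D.Bounded ∧ M.step D = some C ∧ D.label = e ∧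
        M.tour.step (C.check e mv) = some (D.explore 0) := by
  obtain ⟨a, ha, hq, rfl, hf⟩ := h
  set i := M.active (M.edge e).1 with hi
  set s := (M.edge e).2 with hs
  set p := (a.2.2.back s).apply C.tape.length (C.pos i) with hp
  have hrev : (a.2.2.back s).rev.apply C.tape.length p = C.pos i :=
    Move.apply_rev_apply (hC i) hf
  have hpN : p ≤ C.tape.length + 1 := Move.apply_le (hC i) _
  rw [Cfg.check, ← hi, ← hp]
  -- The test compares the symbol found after moving back with the one that the transition would
  -- have left there.
  by_cases hacc : scan C.tape p = s.after a.2.1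
  · right
    have h1 := scan_write_of_eq_after hacc
    have h2 := write_of_eq_after hacc
    let D : Cfg M :=
      { state := (M.edge e).1
        tape := write C.tape s.toBit p
        pos := Function.update C.pos i p }
    have hD : scan D.tape (D.pos (M.active D.state)) = s := by simp [D, ← hi, h1]
    refine ⟨D, ?_, ?_, label_eq_of_edge ?_, ?_⟩
    · intro j
      simp only [D, length_write]
      by_cases hj : j = i
      · subst hj; simpa using hpN
      · simpa [hj] using hC j
    -- With `s` restored, the forward move from `p` is the reverse of the move made for the test, so
    -- it ends at the head position of `C`.
    · have h3 := Move.apply_eq_rev_back a.2.2 (tape := write C.tape s.toBit p) (p := p)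
        (by rwa [length_write])
      rw [h1, length_write, hrev] at h3
      rw [step_eq_some M (a := a) (by rw [hD]; exact ha)]
      simp [D, ← hi, hq, h2, length_write, h3]
    · rw [hD]
    · rw [step_tourCfg (i := i) rfl (a := (.explore (M.edge e).1 0, s.toBit, .stay))
        (by simp [tourTrans, ha, hq, ← hs, hacc])]
      simp [Cfg.explore, D, Move.apply]
  · left
    rw [step_tourCfg (i := i) rfl (a := (.explore C.state e.succ, (scan C.tape p).toBit,
      (a.2.2.back s).rev)) (by simp [tourTrans, ha, ← hs, hacc])]
    simp [Cfg.explore, hrev, write_scan_toBit]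

/-- A genuine predecessor is found under its own label: moving back is never blocked, the written
symbol is still present, and putting the old one back restores `D`. -/
theorem tests_of_step {C D : Cfg M} (hD : D.Bounded) (h : M.step D = some C) :
    ∃ mv, C.Tests D.label mv ∧ M.tour.step (C.check D.label mv) = some (D.explore 0) := by
  cases ht : M.trans D.state (scan D.tape (D.pos (M.active D.state))) with
  | none => simp [step, ht] at h
  | some a =>
    rw [step_eq_some _ ht] at h
    cases h
    refine ⟨_, ⟨a, by rw [edge_label]; exact ht, rfl, rfl, ?_⟩, ?_⟩
    · rw [edge_label]
      simpa using Move.free_back a.2.2 (hD _) (length_write _ _ _)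
    · have hb := Move.back_apply a.2.2 (hD (M.active D.state))
      rw [Cfg.check, step_tourCfg (i := M.active D.state) (by simp [tourActive, edge_label])
        (a := (.explore D.state 0, (scan D.tape (D.pos (M.active D.state))).toBit, .stay))
        (by simp [tourTrans, edge_label, ht, length_write, hb, scan_write])]
      simp only [edge_label, length_write, Function.update_self, hb, write_write,
        write_scan_toBit, Function.update_idem, Move.stay_apply, Function.update_eq_self]
      rfl

end Machine
end InPlace

/-! ### Global behaviour of the tour: it covers each tree, and tours are disjoint -/

namespace InPlace

open StateTransition Relation

theorem Cfg.Bounded.step {M : Machine} {C C' : Cfg M} (hC : C.Bounded) (h : M.step C = some C') :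
    C'.Bounded := by
  have := hC.next
  rwa [Machine.next, h] at this

theorem Machine.length_step {M : Machine} {C C' : Cfg M} (h : M.step C = some C') :
    C'.tape.length = C.tape.length := by
  have := M.length_next C
  rwa [Machine.next, h] at this

/-! ### Finitely many configurations -/

/-- The configurations on tapes of length `N`. -/
def BoundedCfg (M : Machine) (N : ℕ) : Type := { C : Cfg M // C.Bounded ∧ C.tape.length = N }

/-- State, tape and head positions of a configuration on a tape of length `N`. -/
def BoundedCfg.data {M : Machine} {N : ℕ} (C : BoundedCfg M N) :
    M.State × List.Vector Bool N × (Fin M.headCount → Fin (N + 2)) :=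
  (C.1.state, ⟨C.1.tape, C.2.2⟩, fun i => ⟨C.1.pos i, by have := C.2.1 i; have := C.2.2; omega⟩)

theorem BoundedCfg.data_injective {M : Machine} {N : ℕ} :
    Function.Injective (BoundedCfg.data (M := M) (N := N)) := by
  rintro ⟨⟨q, t, p⟩, h⟩ ⟨⟨q', t', p'⟩, h'⟩ heq
  have hq : q = q' := congrArg Prod.fst heq
  have ht : t = t' := congrArg (fun x => x.2.1.1) heq
  have hp : p = p' := funext fun i => congrArg (fun x => (x.2.2 i).val) heq
  subst hq ht hp
  rfl

instance (M : Machine) (N : ℕ) : Finite (BoundedCfg M N) :=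
  Finite.of_injective _ BoundedCfg.data_injective

theorem card_boundedCfg_le (M : Machine) (N : ℕ) :
    Nat.card (BoundedCfg M N) ≤ Nat.card M.State * (2 ^ N * (N + 2) ^ M.headCount) := by
  refine (Nat.card_le_card_of_injective _ BoundedCfg.data_injective).trans_eq ?_
  rw [Nat.card_prod, Nat.card_prod, Nat.card_eq_fintype_card (α := List.Vector Bool N), card_vector,
    Nat.card_fun]
  simp

/-! ### Halting computations -/

namespace Machine

variable {M : Machine}

theorem eq_of_reaches {C R R' : Cfg M} (h : Reaches M.step C R) (hR : M.step R = none)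
    (h' : Reaches M.step C R') (hR' : M.step R' = none) : R = R' :=
  Part.mem_unique (mem_eval.2 ⟨h, hR⟩) (mem_eval.2 ⟨h', hR'⟩)

/-- By determinism a cycle through `C` would pass through every later configuration, including `R`,
which has no successor. -/
theorem not_reaches₁_self {C R : Cfg M} (h : Reaches M.step C R) (hR : M.step R = none) :
    ¬ Reaches₁ M.step C C := by
  induction h using ReflTransGen.head_induction_on with
  | refl =>
    intro h
    obtain ⟨b, hb, -⟩ := TransGen.head'_iff.1 h
    simp [hR] at hb
  | head hb _ ih => exact fun h => ih (TransGen.tail' (reaches₁_fwd h hb) hb)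

theorem reaches_of_step {C C' R : Cfg M} (h : M.step C = some C') (hC : Reaches M.step C R)
    (hR : M.step R = none) : Reaches M.step C' R := by
  rcases ReflTransGen.cases_head hC with rfl | ⟨D, hD, hDR⟩
  · simp [hR] at h
  · cases Option.mem_unique hD h
    exact hDR

theorem reaches_of_le {σ : Type*} {r : σ → σ → Prop} {n : ℕ} {g : Fin (n + 1) → σ}
    (h : ∀ e : Fin n, ReflTransGen r (g e.castSucc) (g e.succ)) {a b : Fin (n + 1)} (hab : a ≤ b) :
    ReflTransGen r (g a) (g b) := by
  induction b using Fin.induction with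
  | zero => rw [Fin.le_zero_iff.1 hab]
  | succ i ih =>
    rcases hab.eq_or_lt with rfl | hab
    · rfl
    · exact (ih (Fin.le_castSucc_iff.2 hab)).trans (h i)

/-- Well-founded induction over the tree above `R`: either number `e` gives no child and the tour
passes on, or the tour descends to a child, completes its subtree by induction and climbs back to
resume at the next number. -/
theorem reaches_explore_succ {R : Cfg M} (hR : M.step R = none) {C : Cfg M} (hC : C.Bounded)
    (hCR : Reaches M.step C R) (e : Fin M.edgeCount) :
    Reaches M.tour.step (C.explore e.castSucc) (C.explore e.succ) := by
  let X := { D : BoundedCfg M C.tape.length // Reaches M.step D.1 R }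
  let r : X → X → Prop := fun D D' => Reaches₁ M.step D.1.1 D'.1.1
  have : IsTrans X r := ⟨fun _ _ _ => TransGen.trans⟩
  have : Std.Irrefl r := ⟨fun D => not_reaches₁_self D.2 hR⟩
  -- Strict reachability has no cycles among configurations leading to `R`, and only finitely many
  -- of them have the given tape length.
  have hwf : WellFounded r := Finite.wellFounded_of_trans_of_irrefl r
  suffices key : ∀ D : X, ∀ e : Fin M.edgeCount,
      Reaches M.tour.step (D.1.1.explore e.castSucc) (D.1.1.explore e.succ) from
    key ⟨⟨C, hC, rfl⟩, hCR⟩ e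
  intro D
  induction D using hwf.induction with
  | _ D ih =>
    intro e
    by_cases ht : ∃ mv, D.1.1.Tests e mv
    · obtain ⟨mv, ht⟩ := ht
      refine ReflTransGen.head (tour_step_explore_of_tests ht) ?_
      rcases tour_step_check D.1.2.1 ht with h | ⟨D', hD', hs, hl, h⟩
      · exact ReflTransGen.single h
      · have h1 := ih ⟨⟨D', hD', (length_step hs).symm.trans D.1.2.2⟩, D.2.head hs⟩
          (TransGen.single hs)
        have h2 := reaches_of_le (g := D'.explore) h1 (Fin.zero_le (Fin.last _))
        rw [← hl]
        exact ReflTransGen.tail (ReflTransGen.head (by rwa [← hl] at h) h2) (tour_step_last hs)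
    · exact ReflTransGen.single (tour_step_explore_of_not_tests (not_exists.1 ht))

/-- The tour starting at `R` visits all configurations from which `R` is reached. -/
theorem reaches_explore_zero {R : Cfg M} (hR : M.step R = none) {S : Cfg M} (hS : S.Bounded)
    (h : Reaches M.step S R) : Reaches M.tour.step (R.explore 0) (S.explore 0) := by
  induction h using ReflTransGen.head_induction_on with
  | refl => exact ReflTransGen.refl
  | head hs hr ih =>
    have hb := hS.step hs
    obtain ⟨mv, ht, h⟩ := tests_of_step hS hs
    -- The tour reaches the parent, advances there to the number of the child, and then descends.
    exact (((ih hb).trans (reaches_of_le (fun e => reaches_explore_succ hR hb hr e)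
      (Fin.zero_le _))).tail (tour_step_explore_of_tests ht)).tail h

end Machine

/-- `Z` occurs in the tour of the configurations from which `R` is reached. -/
def Cfg.Tours {M : Machine} (R : Cfg M) (Z : Cfg M.tour) : Prop :=
  ∃ C : Cfg M, C.Bounded ∧ Reaches M.step C R ∧
    ((∃ e, Z = C.explore e) ∨ ∃ e mv, C.Tests e mv ∧ Z = C.check e mv)

namespace Machine

variable {M : Machine}

/-- A tour step stays at a node, descends to a predecessor or climbs to the successor, and all of
these still lead to `R`; at the root the finished tour halts. -/
theorem _root_.InPlace.Cfg.Tours.next {R : Cfg M} (hR : M.step R = none) {Z : Cfg M.tour}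
    (h : R.Tours Z) : R.Tours (M.tour.next Z) := by
  obtain ⟨C, hC, hCR, ⟨e, rfl⟩ | ⟨e, mv, ht, rfl⟩⟩ := h
  · induction e using Fin.lastCases with
    | last =>
      cases hs : M.step C with
      | none =>
        rw [Machine.next, tour_step_last_none hs]
        exact ⟨C, hC, hCR, .inl ⟨_, rfl⟩⟩
      | some C' =>
        rw [Machine.next, tour_step_last hs]
        exact ⟨C', hC.step hs, reaches_of_step hs hCR hR, .inl ⟨_, rfl⟩⟩
    | cast e =>
      by_cases ht : ∃ mv, C.Tests e mv
      · obtain ⟨mv, ht⟩ := ht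
        rw [Machine.next, tour_step_explore_of_tests ht]
        exact ⟨C, hC, hCR, .inr ⟨e, mv, ht, rfl⟩⟩
      · rw [Machine.next, tour_step_explore_of_not_tests (not_exists.1 ht)]
        exact ⟨C, hC, hCR, .inl ⟨_, rfl⟩⟩
  · rcases tour_step_check hC ht with h | ⟨D, hD, hs, -, h⟩
    · rw [Machine.next, h]
      exact ⟨C, hC, hCR, .inl ⟨_, rfl⟩⟩
    · rw [Machine.next, h]
      exact ⟨D, hD, hCR.head hs, .inl ⟨_, rfl⟩⟩

theorem _root_.InPlace.Cfg.Tours.iterate_next {R : Cfg M} (hR : M.step R = none) {Z : Cfg M.tour}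
    (h : R.Tours Z) (t : ℕ) : R.Tours (M.tour.next^[t] Z) := by
  induction t with
  | zero => exact h
  | succ t ih =>
    rw [Function.iterate_succ_apply']
    exact ih.next hR

theorem tourCfg_inj {q q' : TourState M.State M.edgeCount} {t t' : List Bool}
    {p p' : Fin M.headCount → ℕ} :
    M.tourCfg q t p = M.tourCfg q' t' p' ↔ q = q' ∧ t = t' ∧ p = p' :=
  Cfg.mk.injEq .. |>.to_iff

theorem explore_injective {C C' : Cfg M} {e e' : Fin (M.edgeCount + 1)}
    (h : C.explore e = C'.explore e') : C = C' := by
  obtain ⟨h1, h2, h3⟩ := tourCfg_inj.1 h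
  cases C
  cases C'
  simp_all

/-- During a test the active head is displaced, but by an unblocked move, so reversing that move
recovers the node. -/
theorem check_injective {C C' : Cfg M} (hC : C.Bounded) (hC' : C'.Bounded)
    {e e' : Fin M.edgeCount} {mv mv' : Move} (ht : C.Tests e mv) (ht' : C'.Tests e' mv')
    (h : C.check e mv = C'.check e' mv') : C = C' := by
  obtain ⟨h1, h2, h3⟩ := tourCfg_inj.1 h
  obtain ⟨a, ha, -, rfl, hf⟩ := ht
  obtain ⟨a', ha', -, rfl, hf'⟩ := ht'
  obtain ⟨hq, rfl⟩ := (TourState.check.injEq ..).mp h1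
  cases ha.symm.trans ha'
  obtain ⟨q, t, p⟩ := C
  obtain ⟨q', t', p'⟩ := C'
  dsimp only at *
  subst hq h2
  have hpp : p = p' := by
    funext j
    by_cases hj : j = M.active (M.edge e).1
    · subst hj
      have h4 := congrFun h3 (M.active (M.edge e).1)
      simp only [Function.update_self] at h4
      have h5 := Move.apply_rev_apply (hC (M.active (M.edge e).1)) hf
      have h6 := Move.apply_rev_apply (hC' (M.active (M.edge e).1)) hf'
      dsimp only at h5 h6
      rw [← h5, h4, h6]
    · simpa [hj] using congrFun h3 j
  rw [hpp]

/-- A tour configuration determines its node, and the deterministic run from a node halts in only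
one root. -/
theorem _root_.InPlace.Cfg.Tours.unique {R R' : Cfg M} (hR : M.step R = none)
    (hR' : M.step R' = none) {Z : Cfg M.tour} (h : R.Tours Z) (h' : R'.Tours Z) : R = R' := by
  obtain ⟨C, hC, hCR, hZ⟩ := h
  obtain ⟨C', hC', hCR', hZ'⟩ := h'
  suffices C = C' by
    subst this
    exact eq_of_reaches hCR hR hCR' hR'
  rcases hZ with ⟨e, rfl⟩ | ⟨e, mv, ht, rfl⟩ <;> rcases hZ' with ⟨e', h⟩ | ⟨e', mv', ht', h⟩
  · exact explore_injective h
  · cases (tourCfg_inj.1 h).1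
  · cases (tourCfg_inj.1 h).1
  · exact check_injective hC hC' ht ht' h

/-! ### The search among the configurations of the tour -/

theorem exists_iterate_next {C C' : Cfg M} (h : Reaches M.step C C') :
    ∃ t, M.next^[t] C = C' := by
  induction h using ReflTransGen.head_induction_on with
  | refl => exact ⟨0, rfl⟩
  | head hs _ ih =>
    obtain ⟨t, ht⟩ := ih
    refine ⟨t + 1, ?_⟩
    rw [Function.iterate_succ_apply, Machine.next, hs]
    exact ht

theorem exists_iterate_searchStep (g : M.State) (κ : List (Option Bool)) (C : Cfg M) (T : ℕ) :
    ∃ t, (Cfg.searchStep g κ)^[T] C = M.next^[t] C := by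
  induction T with
  | zero => exact ⟨0, rfl⟩
  | succ T ih =>
    obtain ⟨t, ht⟩ := ih
    rw [Function.iterate_succ_apply', ht, Cfg.searchStep]
    split
    · exact ⟨t, rfl⟩
    · exact ⟨t + 1, (Function.iterate_succ_apply' _ _ _).symm⟩

/-- The search stops changing once it accepts, so rejection at time `T` means that nothing was
accepted earlier and the search coincided with the plain iteration. -/
theorem not_accepts_iterate_next {g : M.State} {κ : List (Option Bool)} {C : Cfg M} {T : ℕ}
    (h : ((Cfg.searchStep g κ)^[T] C).accepts g κ = false) :
    ∀ t ≤ T, (M.next^[t] C).accepts g κ = false := by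
  induction T generalizing C with
  | zero => rintro t ht; obtain rfl := Nat.le_zero.1 ht; exact h
  | succ T ih =>
    rw [Function.iterate_succ_apply, Cfg.searchStep] at h
    cases hC : C.accepts g κ with
    | true =>
      have hfix : ∀ n, (Cfg.searchStep g κ)^[n] C = C :=
        fun n => Function.iterate_fixed (by simp [Cfg.searchStep, hC]) n
      simp [hC, hfix] at h
    | false =>
      rw [hC] at h
      rintro (_ | t) ht
      · exact hC
      · exact ih h t (by omega)

/-- A repetition up to time `T` could be cut out of the orbit, so that `P` would hold before its
first occurrence. -/
theorem iterate_injOn {σ : Type*} {F : σ → σ} {P : σ → Prop} {Z : σ} {T : ℕ}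
    (hP : ∀ t ≤ T, ¬ P (F^[t] Z)) (hex : ∃ t, P (F^[t] Z)) :
    Set.InjOn (fun t => F^[t] Z) (Set.Iic T) := by
  classical
  have key : ∀ i j, i < j → j ≤ T → F^[i] Z ≠ F^[j] Z := by
    intro i j hij hj heq
    have h1 := Nat.find_spec hex
    have hlt : T < Nat.find hex := by
      by_contra h
      exact hP _ (not_lt.1 h) h1
    refine Nat.find_min hex (m := Nat.find hex - j + i) (by omega) ?_
    rwa [Function.iterate_add_apply, heq, ← Function.iterate_add_apply,
      Nat.sub_add_cancel (by omega)]
  intro i hi j hj heq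
  rcases lt_trichotomy i j with h | h | h
  · exact absurd heq (key i j h hj)
  · exact h
  · exact absurd heq.symm (key j i h hi)

end Machine
end InPlace

/-! ### Soundness of the inversion algorithm -/

namespace InPlace

open StateTransition Relation

theorem all_zip_append {l l' : List Bool} {κ κ' : List (Option Bool)} (h : l.length = κ.length) :
    (((l ++ l').zip (κ ++ κ')).all fun c => c.2.all (· == c.1)) =
      (((l.zip κ).all fun c => c.2.all (· == c.1)) &&
        (l'.zip κ').all fun c => c.2.all (· == c.1)) := by
  rw [List.zip_append h, List.all_append]

theorem all_zip_map_some {l τ : List Bool} (h : l.length = τ.length) :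
    ((l.zip (τ.map some)).all fun c => c.2.all (· == c.1)) = true ↔ l = τ := by
  induction l generalizing τ with
  | nil => cases τ <;> simp_all
  | cons a l ih =>
    cases τ with
    | nil => simp at h
    | cons b τ =>
      rw [List.map_cons, List.zip_cons_cons, List.all_cons, Bool.and_eq_true,
        ih (by simpa using h), List.cons.injEq]
      simp [eq_comm (a := a)]

theorem all_zip_replicate_none (l : List Bool) (n : ℕ) :
    ((l.zip (List.replicate n (none : Option Bool))).all fun c => c.2.all (· == c.1)) = true := by
  rw [List.all_eq_true]
  rintro ⟨a, b⟩ h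
  rw [List.eq_of_mem_replicate (List.of_mem_zip h).2]
  rfl

/-- Head positions are not tested; for the start state of a normalized machine they are forced
anyway. -/
theorem accepts_iff {M : Machine} {g : M.State} {C : Cfg M} {n s : ℕ} {τ : List Bool}
    (hC : C.tape.length = n + s + τ.length) :
    C.accepts g (requirements n s τ) = true ↔
      (∃ x : List Bool, x.length = n ∧ C.tape = x ++ List.replicate s false ++ τ) ∧
        C.state = g := by
  have hreq : requirements n s τ =
      List.replicate n none ++ (List.replicate s false ++ τ).map some := by
    simp [requirements]
  have hn : (C.tape.take n).length = n := by simp [hC]; omega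
  simp only [Cfg.accepts, Bool.and_eq_true, decide_eq_true_eq, and_congr_left_iff]
  rw [hreq]
  intro _
  rw [← List.take_append_drop n C.tape, all_zip_append (by simpa using hn), Bool.and_eq_true,
    and_iff_right (all_zip_replicate_none _ _), all_zip_map_some (by simp [hC]; omega)]
  constructor
  · intro h
    exact ⟨_, hn, by rw [h, List.append_assoc]⟩
  · rintro ⟨x, hx, h⟩
    rw [List.append_assoc] at h
    exact (List.append_inj h (hn.trans hx.symm)).2

theorem free_cells {n s : ℕ} {τ x : List Bool} (hx : x.length = n) :
    (((x ++ List.replicate s false ++ τ).zip (requirements n s τ)).filter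
      fun c => c.2.isNone).map (fun c => c.1) = x := by
  have hreq : requirements n s τ =
      List.replicate n none ++ (List.replicate s false ++ τ).map some := by
    simp [requirements]
  rw [hreq, List.append_assoc, List.zip_append (by simpa using hx), List.filter_append,
    List.filter_eq_self.2, List.filter_eq_nil_iff.2, List.append_nil,
    List.map_fst_zip (by simp [hx])]
  · rintro ⟨a, b⟩ h
    obtain ⟨c, -, hc⟩ := List.mem_map.1 (List.of_mem_zip h).2
    simp [← hc]
  · rintro ⟨a, b⟩ h
    rw [List.eq_of_mem_replicate (List.of_mem_zip h).2]
    rfl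

namespace Machine

variable (M : Machine)

/-- The algorithm: follow the tour from the halting configuration with the tape `y ∘ 1^s ∘ τ`,
until an initial configuration with the tape `x ∘ 0^s ∘ τ` occurs. -/
noncomputable def invert (d s : ℕ) (y τ : List Bool) : Option (List Bool) :=
  M.normalize.tour.searchResult (.explore NormState.final 0) (.explore M.normalize.start 0) d
    (startTape y s τ) (requirements y.length s τ)

/-- The final configuration of the normalized machine. -/
noncomputable def finalCfg (t : List Bool) : Cfg M.normalize :=
  M.normalize.leftCfg NormState.final t

theorem step_finalCfg (t : List Bool) : M.normalize.step (M.finalCfg t) = none :=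
  M.step_final t _

theorem bounded_leftCfg (q : M.State) (t : List Bool) : (M.leftCfg q t).Bounded :=
  fun _ => Nat.zero_le _

theorem tours_finalCfg (t : List Bool) : (M.finalCfg t).Tours ((M.finalCfg t).explore 0) :=
  ⟨_, bounded_leftCfg _ _ _, .refl, .inl ⟨0, rfl⟩⟩

theorem iterate_next_bounded {M : Machine} {C : Cfg M} (hC : C.Bounded) (t : ℕ) :
    (M.next^[t] C).Bounded ∧ (M.next^[t] C).tape.length = C.tape.length := by
  induction t with
  | zero => exact ⟨hC, rfl⟩
  | succ t ih =>
    rw [Function.iterate_succ_apply']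
    exact ⟨ih.1.next, (M.length_next _).trans ih.2⟩

variable {M}

/-- All visited configurations belong to the tour of the chosen root, so the node found reaches it.
Being in the normalized start state, that node has its heads at the left marker. -/
theorem reaches_of_invert {d s : ℕ} {y τ x : List Bool} (h : M.invert d s y τ = some x) :
    x.length = y.length ∧ Reaches M.normalize.step
      (M.normalize.leftCfg M.normalize.start (x ++ List.replicate s false ++ τ))
      (M.finalCfg (startTape y s τ)) := by
  unfold invert searchResult at h
  extract_lets Z at h
  have hZ : Z.tape.length = y.length + s + τ.length := by
    rw [← length_startTape]
    exact (Cfg.iterate_searchStep (M.normalize.tour.bounded_leftCfg _ _) _).2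
  split_ifs at h with hacc
  obtain ⟨⟨x', hx', ht⟩, hs⟩ := (accepts_iff hZ).1 hacc
  rw [ht, free_cells hx', Option.some_inj] at h
  subst h
  refine ⟨hx', ?_⟩
  obtain ⟨t, hiter⟩ := exists_iterate_searchStep (M := M.normalize.tour)
    (.explore M.normalize.start 0) (requirements y.length s τ)
    ((M.finalCfg (startTape y s τ)).explore 0) (((startTape y s τ).length + 2) ^ d)
  have htour := (M.tours_finalCfg (startTape y s τ)).iterate_next (M.step_finalCfg _) t
  rw [← hiter] at htour
  change Cfg.Tours _ Z at htour
  obtain ⟨C, -, hCR, ⟨e, hC⟩ | ⟨e, mv, -, hC⟩⟩ := htour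
  · rw [hC] at ht hs
    have hstart : C.state = M.normalize.start := (TourState.explore.injEq ..).mp hs |>.1
    rw [eq_leftCfg_of_reaches M hstart hCR] at hCR
    rw [← ht]
    exact hCR
  · rw [hC] at hs
    cases hs

/-- Failure means no acceptance within the time limit, whereas the tour does visit the start
configuration for `x` at some time; so no repetition can have occurred. -/
theorem injOn_of_invert {d s : ℕ} {y τ x : List Bool} (hx : x.length = y.length)
    (hM : M.HaltsWith (x ++ List.replicate s false ++ τ) (startTape y s τ))
    (h : M.invert d s y τ = none) :
    Set.InjOn (fun t => M.normalize.tour.next^[t] ((M.finalCfg (startTape y s τ)).explore 0))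
      (Set.Iic (((startTape y s τ).length + 2) ^ d)) := by
  unfold invert searchResult at h
  extract_lets Z at h
  split_ifs at h with hacc
  refine iterate_injOn
    (P := fun C => C.accepts (TourState.explore M.normalize.start 0)
      (requirements y.length s τ) = true)
    (fun t ht => ?_) ?_
  · rw [Bool.not_eq_true]
    exact not_accepts_iterate_next (Bool.eq_false_iff.2 hacc) t ht
  · obtain ⟨t, ht⟩ := exists_iterate_next (reaches_explore_zero (M.step_finalCfg _)
      (bounded_leftCfg _ _ _) hM.normalize)
    refine ⟨t, ?_⟩
    erw [ht]
    refine (accepts_iff ?_).2 ⟨⟨x, hx, rfl⟩, rfl⟩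
    change (x ++ List.replicate s false ++ τ).length = _
    simp [hx, add_assoc]

end Machine

/-! ### Counting the failures -/

section Counting

variable {M : Machine} {n s ℓ : ℕ} {F : Equiv.Perm (Fin n → Bool)}

/-- The answer leads forward to the halting configuration of `y`; by determinism this is also the
one of its image, which is therefore `y`. -/
theorem invert_eq_or (H : ∀ (x : Fin n → Bool) (τ : Fin ℓ → Bool), M.HaltsWith
      (List.ofFn x ++ List.replicate s false ++ List.ofFn τ)
      (startTape (List.ofFn (F x)) s (List.ofFn τ))) (d : ℕ)
    (y : Fin n → Bool) (τ : Fin ℓ → Bool) :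
    M.invert d s (List.ofFn y) (List.ofFn τ) = some (List.ofFn (F.symm y)) ∨
      M.invert d s (List.ofFn y) (List.ofFn τ) = none := by
  cases h : M.invert d s (List.ofFn y) (List.ofFn τ) with
  | none => exact .inr rfl
  | some z =>
    left
    obtain ⟨hz, hr⟩ := M.reaches_of_invert h
    rw [List.length_ofFn] at hz
    subst hz
    have h1 := (H z.get τ).normalize
    rw [List.ofFn_get] at h1
    have h2 := congrArg Cfg.tape
      (Machine.eq_of_reaches hr (M.step_finalCfg _) h1 (M.step_finalCfg _))
    have h3 : startTape (List.ofFn y) s (List.ofFn τ) =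
      startTape (List.ofFn (F z.get)) s (List.ofFn τ) := h2
    have h4 : y = F z.get := by
      refine List.ofFn_injective (List.append_inj_left' (t₁ := List.replicate s true ++ List.ofFn τ)
        (t₂ := List.replicate s true ++ List.ofFn τ) ?_ rfl)
      simpa [startTape] using h3
    rw [h4, Equiv.symm_apply_apply, List.ofFn_get]

theorem startTape_injective {y y' : Fin n → Bool} {τ τ' : Fin ℓ → Bool}
    (h : startTape (List.ofFn y) s (List.ofFn τ) = startTape (List.ofFn y') s (List.ofFn τ')) :
    (y, τ) = (y', τ') := by
  obtain ⟨h1, h2⟩ := List.append_inj' h (by simp)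
  obtain ⟨h3, -⟩ := List.append_inj' h1 rfl
  rw [List.ofFn_injective h3, List.ofFn_injective h2]

/-- Pairs of a failing input and a time below the limit inject into the tour configurations:
disjointness of tours recovers the input, and the absence of repetitions recovers the time. -/
theorem card_invert_eq_none_mul_le (H : ∀ (x : Fin n → Bool) (τ : Fin ℓ → Bool), M.HaltsWith
      (List.ofFn x ++ List.replicate s false ++ List.ofFn τ)
      (startTape (List.ofFn (F x)) s (List.ofFn τ))) (d : ℕ) :
    Nat.card {p : (Fin n → Bool) × (Fin ℓ → Bool) //
        M.invert d s (List.ofFn p.1) (List.ofFn p.2) = none} * (n + s + ℓ + 2) ^ d ≤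
      Nat.card M.normalize.tour.State *
        (2 ^ (n + s + ℓ) * (n + s + ℓ + 2) ^ M.headCount) := by
  refine le_trans (le_of_eq ?_) ((Nat.card_le_card_of_injective
      (α := {p : (Fin n → Bool) × (Fin ℓ → Bool) //
        M.invert d s (List.ofFn p.1) (List.ofFn p.2) = none} × Fin ((n + s + ℓ + 2) ^ d))
      (β := BoundedCfg M.normalize.tour (n + s + ℓ))
      (fun p => ⟨M.normalize.tour.next^[p.2.val] ((M.finalCfg
        (startTape (List.ofFn p.1.1.1) s (List.ofFn p.1.1.2))).explore 0), ?_⟩) ?_).trans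
      (card_boundedCfg_le M.normalize.tour (n + s + ℓ)))
  · rw [Nat.card_prod, Nat.card_fin]
  · have := Machine.iterate_next_bounded (M := M.normalize.tour) (C := (M.finalCfg
        (startTape (List.ofFn p.1.1.1) s (List.ofFn p.1.1.2))).explore 0)
        (fun _ => Nat.zero_le _) p.2.val
    refine ⟨this.1, this.2.trans ?_⟩
    exact (length_startTape _ _ _).trans (by simp)
  · rintro ⟨⟨⟨y, τ⟩, hp⟩, t⟩ ⟨⟨⟨y', τ'⟩, hp'⟩, t'⟩ heq
    have heq := congrArg Subtype.val heq
    dsimp only at heq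
    have h1 := (M.tours_finalCfg (startTape (List.ofFn y) s (List.ofFn τ))).iterate_next
      (M.step_finalCfg _) t
    rw [heq] at h1
    have h2 := (M.tours_finalCfg (startTape (List.ofFn y') s (List.ofFn τ'))).iterate_next
      (M.step_finalCfg _) t'
    have h3 := congrArg Cfg.tape (h1.unique (M.step_finalCfg _) (M.step_finalCfg _) h2)
    cases startTape_injective h3
    have hH := H (F.symm y) τ
    rw [Equiv.apply_symm_apply] at hH
    have hlen : (startTape (List.ofFn y) s (List.ofFn τ)).length = n + s + ℓ := by
      simp [length_startTape]
    have h4 := Machine.injOn_of_invert (by simp) hH hp (x₁ := t.val) (x₂ := t'.val)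
      (by rw [hlen]; exact t.2.le) (by rw [hlen]; exact t'.2.le) heq
    rw [Fin.ext h4]

/-- Logarithmic work space increases the number of tapes only by a polynomial factor. -/
theorem two_pow_clog_le (n : ℕ) : 2 ^ Nat.clog 2 n ≤ (n + 2) ^ 2 := by
  rcases Nat.lt_or_ge n 2 with hn | hn
  · rw [Nat.clog_of_right_le_one (by omega)]
    nlinarith
  · have h1 := Nat.pow_pred_clog_lt_self (b := 2) (by omega) hn
    have h2 : Nat.clog 2 n = (Nat.clog 2 n).pred + 1 :=
      (Nat.succ_pred (Nat.clog_pos (by omega) hn).ne').symm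
    rw [h2, pow_succ]
    nlinarith

/-- The degree of the polynomial that bounds the length of the search. -/
noncomputable def searchDegree (M : Machine) (k c : ℕ) : ℕ :=
  c + M.headCount + 2 * k + Nat.card M.normalize.tour.State

/-- `searchDegree` pays for each factor separately: `c` for the error, the head count for the head
positions, `2 * k` for `2 ^ s`, and the number of states `Q` through the crude `Q ≤ B ^ Q`. -/
theorem card_invert_eq_none_mul_pow_le {k : ℕ}
    (H : ∀ (x : Fin n → Bool) (τ : Fin ℓ → Bool), M.HaltsWith
      (List.ofFn x ++ List.replicate (k * Nat.clog 2 n) false ++ List.ofFn τ)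
      (startTape (List.ofFn (F x)) (k * Nat.clog 2 n) (List.ofFn τ))) (c : ℕ) :
    Nat.card {p : (Fin n → Bool) × (Fin ℓ → Bool) //
        M.invert (searchDegree M k c) (k * Nat.clog 2 n) (List.ofFn p.1) (List.ofFn p.2) = none} *
      n ^ c ≤ 2 ^ (n + ℓ) := by
  have h := card_invert_eq_none_mul_le H (searchDegree M k c)
  set A := Nat.card {p : (Fin n → Bool) × (Fin ℓ → Bool) //
    M.invert (searchDegree M k c) (k * Nat.clog 2 n) (List.ofFn p.1) (List.ofFn p.2) = none}
  set Q := Nat.card M.normalize.tour.State with hQ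
  set s := k * Nat.clog 2 n with hs
  set B := n + s + ℓ + 2 with hB
  have hB0 : 0 < B := by omega
  have h1 : n ^ c ≤ B ^ c := Nat.pow_le_pow_left (by omega) c
  have h2 : Q ≤ B ^ Q := (Nat.lt_pow_self (by omega)).le
  have h3 : 2 ^ s ≤ B ^ (2 * k) := by
    rw [hs, mul_comm k, pow_mul, pow_mul]
    exact Nat.pow_le_pow_left ((two_pow_clog_le n).trans (Nat.pow_le_pow_left (by omega) 2)) k
  have hpos : 0 < B ^ M.headCount * B ^ (2 * k) * B ^ Q := by positivity
  refine Nat.le_of_mul_le_mul_right ?_ hpos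
  calc A * n ^ c * (B ^ M.headCount * B ^ (2 * k) * B ^ Q)
      ≤ A * B ^ c * (B ^ M.headCount * B ^ (2 * k) * B ^ Q) := by gcongr
    _ = A * B ^ searchDegree M k c := by
        rw [searchDegree, ← hQ, pow_add, pow_add, pow_add]; ring
    _ ≤ Q * (2 ^ (n + s + ℓ) * B ^ M.headCount) := h
    _ = 2 ^ (n + ℓ) * (B ^ M.headCount * 2 ^ s * Q) := by
        rw [pow_add, pow_add, pow_add]; ring
    _ ≤ 2 ^ (n + ℓ) * (B ^ M.headCount * B ^ (2 * k) * B ^ Q) := by gcongr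

end Counting

/-- The multiplied form avoids division and covers `n = 0`, where the bound on the right is infinite
for `c > 0`. -/
theorem uniformProb_le {α : Type} [Fintype α] [Nonempty α] {E : Set α} {n c : ℕ}
    (h : Nat.card E * n ^ c ≤ Nat.card α) : uniformProb E ≤ ((n : ENNReal) ^ c)⁻¹ := by
  classical
  rw [uniformProb, PMF.toOuterMeasure_uniformOfFintype_apply, ← Nat.card_eq_fintype_card,
    ← Nat.card_eq_fintype_card]
  refine ENNReal.div_le_of_le_mul ?_
  rw [mul_comm, ← div_eq_mul_inv]
  have hα : (Nat.card α : ENNReal) ≠ 0 := by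
    rw [Nat.card_eq_fintype_card]
    exact_mod_cast Fintype.card_ne_zero
  refine (ENNReal.le_div_iff_mul_le (.inr hα) (.inl (by simp))).2 ?_
  exact_mod_cast h

theorem avgP_of_inplaceFL {f : ∀ n : ℕ, Equiv.Perm (Fin n → Bool)}
    (h : InplaceFL (m := fun n => n) fun n x => f n x) (c : ℕ) :
    AvgP (fun n => ((n : ENNReal) ^ c)⁻¹) (m := fun n => n) fun n y => (f n).symm y := by
  obtain ⟨k, M, hM⟩ := h
  -- Without catalytic space, this is the catalytic situation with empty `τ`.
  have H : ∀ (n : ℕ) (x : Fin n → Bool) (τ : Fin 0 → Bool), M.HaltsWith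
      (List.ofFn x ++ List.replicate (k * Nat.clog 2 n) false ++ List.ofFn τ)
      (startTape (List.ofFn (f n x)) (k * Nat.clog 2 n) (List.ofFn τ)) := by
    intro n x τ
    simpa [startTape] using hM n x
  refine ⟨fun z => M.invert (searchDegree M k c) (k * Nat.clog 2 z.1) (List.ofFn z.2) [], ?_,
    fun n => ⟨fun y => ?_, uniformProb_le ?_⟩⟩
  · refine Prg.nonempty_computable M.normalize.tour some k (searchDegree M k c)
      (.explore NormState.final 0) (.explore M.normalize.start 0) encodeInput
      (fun z => List.ofFn z.2) (fun _ => []) (fun z => ?_) _ fun z => ?_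
    · exact ⟨List.ofFn z.2, [], [], by simp [encodeInput], rfl, rfl, rfl, rfl⟩
    · simp only [Machine.invert, List.length_ofFn]
  · simpa using invert_eq_or (H n) (searchDegree M k c) y Fin.elim0
  · have h1 := card_invert_eq_none_mul_pow_le (H n) c
    have h2 : Nat.card {x : Fin n → Bool // M.invert (searchDegree M k c) (k * Nat.clog 2 n)
        (List.ofFn x) [] = none} ≤ _ :=
      Nat.card_le_card_of_injective (β := {p : (Fin n → Bool) × (Fin 0 → Bool) //
        M.invert (searchDegree M k c) (k * Nat.clog 2 n) (List.ofFn p.1) (List.ofFn p.2) = none})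
        (fun x => ⟨(x.1, Fin.elim0), by simpa using x.2⟩)
        (fun x x' hx => Subtype.ext (congrArg (fun p => p.1.1) hx))
    refine (Nat.mul_le_mul_right _ h2).trans (h1.trans (le_of_eq ?_))
    simp

theorem avgZPP_of_inplaceFCL {f : ∀ n : ℕ, Equiv.Perm (Fin n → Bool)}
    (h : InplaceFCL (m := fun n => n) fun n x => f n x) (c : ℕ) :
    AvgZPP (fun n => ((n : ENNReal) ^ c)⁻¹) (m := fun n => n) fun n y => (f n).symm y := by
  obtain ⟨k, M, hM⟩ := h
  have hℓ : ∀ n : ℕ, (Polynomial.X ^ k : Polynomial ℕ).eval n = n ^ k := by simp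
  have H : ∀ (n : ℕ) (x : Fin n → Bool) (τ : Fin ((Polynomial.X ^ k : Polynomial ℕ).eval n) → Bool),
      M.HaltsWith
      (List.ofFn x ++ List.replicate (k * Nat.clog 2 n) false ++ List.ofFn τ)
      (startTape (List.ofFn (f n x)) (k * Nat.clog 2 n) (List.ofFn τ)) := by
    intro n
    -- The length is rewritten while `τ` is still bound, so that its type changes along.
    rw [hℓ n]
    intro x τ
    simpa [startTape] using hM n x τ
  refine ⟨Polynomial.X ^ k, fun z => M.invert (searchDegree M k c) (k * Nat.clog 2 z.1)
    (List.ofFn z.2.1) (List.ofFn z.2.2), ?_, fun n => ⟨fun y τ => ?_, uniformProb_le ?_⟩⟩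
  · refine Prg.nonempty_computable M.normalize.tour id k (searchDegree M k c)
      (.explore NormState.final 0) (.explore M.normalize.start 0) (encodeRandInput _)
      (fun z => List.ofFn z.2.1) (fun z => List.ofFn z.2.2) (fun z => ?_) _ fun z => ?_
    · exact ⟨(List.ofFn z.2.1).map some, (List.ofFn z.2.2).map some,
        none :: (List.ofFn z.2.2).map some, rfl, by simp, rfl, rfl, by simp⟩
    · simp only [Machine.invert, List.length_ofFn]
  · exact invert_eq_or (H n) (searchDegree M k c) y τ
  · refine (card_invert_eq_none_mul_pow_le (H n) c).trans (le_of_eq ?_)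
    simp [pow_add]

end InPlace

theorem mainTheorem4 (f : ∀ n : ℕ, Equiv.Perm (Fin n → Bool)) :
    (InPlace.InplaceFL (m := fun n => n) (fun n x => f n x) →
      ∀ c : ℕ, InPlace.AvgP (fun n => ((n : ENNReal) ^ c)⁻¹)
        (m := fun n => n) (fun n y => (f n).symm y)) ∧
    (InPlace.InplaceFCL (m := fun n => n) (fun n x => f n x) →
      ∀ c : ℕ, InPlace.AvgZPP (fun n => ((n : ENNReal) ^ c)⁻¹)
        (m := fun n => n) (fun n y => (f n).symm y)) :=
  ⟨InPlace.avgP_of_inplaceFL, InPlace.avgZPP_of_inplaceFCL⟩
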